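/- **Conventions.** A $C^\infty$-ring is a set $\mathfrak C$ with an operation $\Phi_f:\mathfrak C^n\to\mathfrak C$ for every $n\ge 0$ and every smooth $f:\mathbb R^n\to\mathbb R$, compatible with composition of smooth functions and with the coordinate functions; it is in particular a commutative $\mathbb R$-algebra, and a $\mathfrak C$-module is a module over this algebra. $\mathfrak C$ is *finitely generated* if there are $c_1,\dots,c_n\in\mathfrak C$ such that every element of $\mathfrak C$ is $\Phi_f(c_1,\dots,c_n)$ for some smooth $f$. An $\mathbb R$-point is a morphism of $C^\infty$-rings $x:\mathfrak C\to\mathbb R$; $\pi_x:\mathfrak C\to\mathfrak C_x$ denotes the localization, in $C^\infty$-rings, of $\mathfrak C$ at $\{s: x(s)\ne 0\}$. $\mathfrak C$ is *fair* if it is finitely generated and any $c\in\mathfrak C$ with $\pi_x(c)=0$ for all $\mathbb R$-points $x$ is zero. $\operatorname{Spec}\mathfrak C=(X,\mathcal O_X)$: $X$ is the set of $\mathbb R$-points with the weakest topology making all maps $x\mapsto x(c)$ continuous, and $\mathcal O_X(U)$ is the $C^\infty$-ring of functions $s:U\to\coprod_{x\in U}\mathfrak C_x$, $s(x)\in\mathfrak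 C_x$, that are locally of the form $x\mapsto\pi_x(c)\pi_x(d)^{-1}$ with $c,d\in\mathfrak C$ and $x(d)\neq 0$. There is a natural morphism $\mathfrak C\to\mathcal O_X(U)$, $c\mapsto(x\mapsto\pi_x(c))$. For a $\mathfrak C$-module $M$, $\operatorname{MSpec}M$ is the sheaf of $\mathcal O_X$-modules associated to the presheaf $U\mapsto M\otimes_{\mathfrak C}\mathcal O_X(U)$. For an $\mathcal O_X$-module $\mathcal E$, $\Gamma(\mathcal E)=\mathcal E(X)$, regarded as a $\mathfrak C$-module via $\mathfrak C\to\mathcal O_X(X)$. The functor $\operatorname{MSpec}$ is left adjoint to $\Gamma$, and $\Phi_M:M\to\Gamma(\operatorname{MSpec}M)$ is the unit of this adjunction. A family $(m_a)_{a\in A}$ in a $\mathfrak C$-module $M$ is a *locally finite sum* if $X$ can be covered by open sets $U$ such that for all but finitely many $a\in A$ the image of $m_a$ in $M\otimes_{\mathfrak C}\mathfrak C_x$ is zero for all $x\in U$; $m\in M$ is a *limit* of it if for every $x\in X$ the image of $m$ in $M\otimes_{\mathfrak C}\mathfrak C_x$ is the sum of the images of the $m_a$. $M$ is *complete* if every locally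 finite sum in $M$ has a unique limit. $R^{\rm co}_{\rm all}$ denotes the reflection functor onto complete modules, that is, the left adjoint of the inclusion of the full subcategory of complete modules into all modules, and $\pi:M\to R^{\rm co}_{\rm all}(M)$ is its unit; the same notation is used for modules over the $C^\infty$-ring $\mathcal O_X(U)$. **Theorem.** Let $\mathfrak C$ be a fair $C^\infty$-ring and $(X,\mathcal O_X)=\operatorname{Spec}\mathfrak C$. (a) The reflection functor $R^{\rm co}_{\rm all}$ for $\mathfrak C$-modules exists, and there are isomorphisms $\Gamma(\operatorname{MSpec}M)\cong R^{\rm co}_{\rm all}(M)$, natural in the $\mathfrak C$-module $M$, which identify $\Phi_M$ with $\pi:M\to R^{\rm co}_{\rm all}(M)$. If $M$ is complete, then $\Phi_M$ is an isomorphism. (b) For every $\mathcal O_X$-module $\mathcal E$ the $\mathfrak C$-module $\Gamma(\mathcal E)$ is complete, and the counit $\operatorname{MSpec}\Gamma(\mathcal E)\to\mathcal E$ of the adjunction is an isomorphism, natural in $\mathcal E$. (c) $\operatorname{MSpec}$ and $\Gamma$ restrict to an equivalence between the category of complete $\mathfrak C$-modules and the category of $\mathcal O_X$-modules. (d) For every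 open $U\subseteq X$ the reflection functor $R^{\rm co}_{\rm all}$ for $\mathcal O_X(U)$-modules exists, and there are isomorphisms of $\mathcal O_X(U)$-modules $(\operatorname{MSpec}M)(U)\cong R^{\rm co}_{\rm all}\bigl(M\otimes_{\mathfrak C}\mathcal O_X(U)\bigr)$, natural in the $\mathfrak C$-module $M$, which identify the canonical map $M\otimes_{\mathfrak C}\mathcal O_X(U)\to(\operatorname{MSpec}M)(U)$ with the unit $\pi$. (e) If $M$ is a finitely presented $\mathfrak C$-module and $U\subseteq X$ is open, then the canonical map $M\otimes_{\mathfrak C}\mathcal O_X(U)\to(\operatorname{MSpec}M)(U)$ is an isomorphism of $\mathcal O_X(U)$-modules. Parts (d) and (e) hold more generally whenever $\mathfrak C$ is finitely generated. -/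

import Mathlib

open CategoryTheory TopologicalSpace Opposite
open scoped ContDiff TensorProduct

universe u v

/-! ### `C^∞`-rings -/

/-- The set `C^∞(ℝⁿ)` of smooth functions `ℝⁿ → ℝ`. -/
def SmoothFun (n : ℕ) : Type := {f : (Fin n → ℝ) → ℝ // ContDiff ℝ ∞ f}

namespace SmoothFun

/-- The coordinate function `π_j`. -/
def proj {n : ℕ} (j : Fin n) : SmoothFun n := ⟨fun x => x j, contDiff_apply ℝ ℝ j⟩

/-- The composition `x ↦ g (f₁ x, …, f_m x)`. -/
def comp {m n : ℕ} (g : SmoothFun m) (f : Fin m → SmoothFun n) : SmoothFun n :=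
  ⟨fun x => g.1 fun i => (f i).1 x, g.2.comp (contDiff_pi.2 fun i => (f i).2)⟩

/-- A constant function. -/
def const (n : ℕ) (r : ℝ) : SmoothFun n := ⟨fun _ => r, contDiff_const⟩

/-- The function `(x, y) ↦ x + y`. -/
def add : SmoothFun 2 := ⟨fun x => x 0 + x 1, (proj 0).2.add (proj 1).2⟩

/-- The function `(x, y) ↦ x y`. -/
def mul : SmoothFun 2 := ⟨fun x => x 0 * x 1, (proj 0).2.mul (proj 1).2⟩

/-- The function `x ↦ r x`. -/
def scale (r : ℝ) : SmoothFun 1 := ⟨fun x => r * x 0, contDiff_const.mul (proj 0).2⟩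

end SmoothFun

/-- A `C^∞`-ring: a set with an operation `Φ_f` for each smooth `f : ℝⁿ → ℝ`, compatible with
composition and with the coordinate functions. -/
class CInftyRing (C : Type u) where
  op : ∀ {n : ℕ}, SmoothFun n → (Fin n → C) → C
  op_comp : ∀ {m n : ℕ} (g : SmoothFun m) (f : Fin m → SmoothFun n) (c : Fin n → C),
    op (g.comp f) c = op g fun i => op (f i) c
  op_proj : ∀ {n : ℕ} (j : Fin n) (c : Fin n → C), op (SmoothFun.proj j) c = c j

namespace CInftyRing

variable {C : Type u} [CInftyRing C]

/-! The underlying commutative `ℝ`-algebra. -/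

instance instAdd : Add C := ⟨fun a b => op SmoothFun.add ![a, b]⟩
instance instMul : Mul C := ⟨fun a b => op SmoothFun.mul ![a, b]⟩
instance instSMul : SMul ℝ C := ⟨fun r a => op (SmoothFun.scale r) ![a]⟩
instance instZero : Zero C := ⟨op (SmoothFun.const 0 0) ![]⟩
instance instOne : One C := ⟨op (SmoothFun.const 0 1) ![]⟩
instance instNeg : Neg C := ⟨fun a => (-1 : ℝ) • a⟩

theorem add_def (a b : C) : a + b = op SmoothFun.add ![a, b] := rfl
theorem mul_def (a b : C) : a * b = op SmoothFun.mul ![a, b] := rfl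
theorem smul_def (r : ℝ) (a : C) : r • a = op (SmoothFun.scale r) ![a] := rfl
theorem zero_def : (0 : C) = op (SmoothFun.const 0 0) ![] := rfl
theorem one_def : (1 : C) = op (SmoothFun.const 0 1) ![] := rfl
theorem neg_def (a : C) : -a = (-1 : ℝ) • a := rfl

theorem op_add_op {n : ℕ} (f g : SmoothFun n) (c : Fin n → C) :
    op f c + op g c = op (SmoothFun.add.comp ![f, g]) c := by
  rw [op_comp, add_def]; congr 1; funext i; fin_cases i <;> rfl

theorem op_mul_op {n : ℕ} (f g : SmoothFun n) (c : Fin n → C) :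
    op f c * op g c = op (SmoothFun.mul.comp ![f, g]) c := by
  rw [op_comp, mul_def]; congr 1; funext i; fin_cases i <;> rfl

theorem smul_op {n : ℕ} (r : ℝ) (f : SmoothFun n) (c : Fin n → C) :
    r • op f c = op ((SmoothFun.scale r).comp ![f]) c := by
  rw [op_comp, smul_def]; congr 1; funext i; fin_cases i; rfl

theorem neg_op {n : ℕ} (f : SmoothFun n) (c : Fin n → C) :
    -op f c = op ((SmoothFun.scale (-1)).comp ![f]) c := smul_op _ _ _

theorem const_op {n : ℕ} (r : ℝ) (c : Fin n → C) :
    op (SmoothFun.const 0 r) ![] = op (SmoothFun.const n r) c := by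
  have h : SmoothFun.const n r = (SmoothFun.const 0 r).comp ![] := rfl
  rw [h, op_comp]; congr 1; funext i; exact i.elim0

theorem zero_op {n : ℕ} (c : Fin n → C) : (0 : C) = op (SmoothFun.const n 0) c := const_op 0 c
theorem one_op {n : ℕ} (c : Fin n → C) : (1 : C) = op (SmoothFun.const n 1) c := const_op 1 c

theorem op_ext {n : ℕ} {f g : SmoothFun n} (h : ∀ x, f.1 x = g.1 x) (c : Fin n → C) :
    op f c = op g c := by
  have : f = g := Subtype.ext (funext h)
  rw [this]

theorem exists_gen (a b c : C) : ∃ v : Fin 3 → C, a = op (SmoothFun.proj 0) v ∧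
    b = op (SmoothFun.proj 1) v ∧ c = op (SmoothFun.proj 2) v :=
  ⟨![a, b, c], (op_proj 0 ![a, b, c]).symm, (op_proj 1 ![a, b, c]).symm,
    (op_proj 2 ![a, b, c]).symm⟩

/-- The underlying commutative ring of a `C^∞`-ring. -/
instance toCommRing : CommRing C where
  add_assoc a b c := by
    obtain ⟨v, rfl, rfl, rfl⟩ := exists_gen a b c
    simp only [op_add_op]; exact op_ext (fun x => add_assoc (x 0) (x 1) (x 2)) v
  zero_add a := by
    obtain ⟨v, rfl, -, -⟩ := exists_gen a a a
    rw [zero_op v, op_add_op]; exact op_ext (fun x => zero_add (x 0)) v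
  add_zero a := by
    obtain ⟨v, rfl, -, -⟩ := exists_gen a a a
    rw [zero_op v, op_add_op]; exact op_ext (fun x => add_zero (x 0)) v
  add_comm a b := by
    obtain ⟨v, rfl, rfl, -⟩ := exists_gen a b a
    simp only [op_add_op]; exact op_ext (fun x => add_comm (x 0) (x 1)) v
  left_distrib a b c := by
    obtain ⟨v, rfl, rfl, rfl⟩ := exists_gen a b c
    simp only [op_add_op, op_mul_op]; exact op_ext (fun x => mul_add (x 0) (x 1) (x 2)) v
  right_distrib a b c := by
    obtain ⟨v, rfl, rfl, rfl⟩ := exists_gen a b c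
    simp only [op_add_op, op_mul_op]; exact op_ext (fun x => add_mul (x 0) (x 1) (x 2)) v
  zero_mul a := by
    obtain ⟨v, rfl, -, -⟩ := exists_gen a a a
    rw [zero_op v, op_mul_op]; exact op_ext (fun x => zero_mul (x 0)) v
  mul_zero a := by
    obtain ⟨v, rfl, -, -⟩ := exists_gen a a a
    rw [zero_op v, op_mul_op]; exact op_ext (fun x => mul_zero (x 0)) v
  mul_assoc a b c := by
    obtain ⟨v, rfl, rfl, rfl⟩ := exists_gen a b c
    simp only [op_mul_op]; exact op_ext (fun x => mul_assoc (x 0) (x 1) (x 2)) v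
  one_mul a := by
    obtain ⟨v, rfl, -, -⟩ := exists_gen a a a
    rw [one_op v, op_mul_op]; exact op_ext (fun x => one_mul (x 0)) v
  mul_one a := by
    obtain ⟨v, rfl, -, -⟩ := exists_gen a a a
    rw [one_op v, op_mul_op]; exact op_ext (fun x => mul_one (x 0)) v
  neg_add_cancel a := by
    obtain ⟨v, rfl, -, -⟩ := exists_gen a a a
    rw [neg_op, zero_op v, op_add_op]
    exact op_ext (fun x => show -1 * x 0 + x 0 = 0 by ring) v
  mul_comm a b := by
    obtain ⟨v, rfl, rfl, -⟩ := exists_gen a b a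
    simp only [op_mul_op]; exact op_ext (fun x => mul_comm (x 0) (x 1)) v
  nsmul := nsmulRec
  zsmul := zsmulRec

instance toModule : Module ℝ C where
  one_smul a := by
    obtain ⟨v, rfl, -, -⟩ := exists_gen a a a
    rw [smul_op]; exact op_ext (fun x => one_mul (x 0)) v
  mul_smul r s a := by
    obtain ⟨v, rfl, -, -⟩ := exists_gen a a a
    simp only [smul_op]; exact op_ext (fun x => mul_assoc r s (x 0)) v
  smul_zero r := by
    rw [zero_def, smul_op]; exact op_ext (fun x => mul_zero r) _
  smul_add r a b := by
    obtain ⟨v, rfl, rfl, -⟩ := exists_gen a b a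
    simp only [smul_op, op_add_op]; exact op_ext (fun x => mul_add r (x 0) (x 1)) v
  add_smul r s a := by
    obtain ⟨v, rfl, -, -⟩ := exists_gen a a a
    simp only [smul_op, op_add_op]; exact op_ext (fun x => add_mul r s (x 0)) v
  zero_smul a := by
    obtain ⟨v, rfl, -, -⟩ := exists_gen a a a
    rw [smul_op, zero_op v]; exact op_ext (fun x => zero_mul (x 0)) v

/-- The underlying commutative `ℝ`-algebra of a `C^∞`-ring. -/
instance toAlgebra : Algebra ℝ C :=
  Algebra.ofModule
    (fun r a b => by
      obtain ⟨v, rfl, rfl, -⟩ := exists_gen a b a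
      simp only [smul_op, op_mul_op]; exact op_ext (fun x => mul_assoc r (x 0) (x 1)) v)
    (fun r a b => by
      obtain ⟨v, rfl, rfl, -⟩ := exists_gen a b a
      simp only [smul_op, op_mul_op]; exact op_ext (fun x => mul_left_comm (x 0) r (x 1)) v)

variable (C) in
/-- `C` is finitely generated: some `c₁, …, c_n` generate it under all `C^∞`-operations. -/
def IsFinitelyGenerated : Prop :=
  ∃ (n : ℕ) (c : Fin n → C), ∀ a : C, ∃ f : SmoothFun n, a = op f c

end CInftyRing

/-- A morphism of `C^∞`-rings. -/
structure CInftyHom (C : Type u) (D : Type v) [CInftyRing C] [CInftyRing D] where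
  toFun : C → D
  map_op : ∀ {n : ℕ} (f : SmoothFun n) (c : Fin n → C),
    toFun (CInftyRing.op f c) = CInftyRing.op f fun i => toFun (c i)

namespace CInftyHom

variable {C : Type u} {D : Type v} [CInftyRing C] [CInftyRing D]

/-- The ring homomorphism underlying a morphism of `C^∞`-rings. -/
def toRingHom (φ : CInftyHom C D) : C →+* D where
  toFun := φ.toFun
  map_zero' := by
    rw [CInftyRing.zero_def, φ.map_op, CInftyRing.zero_op]
  map_one' := by
    rw [CInftyRing.one_def, φ.map_op, CInftyRing.one_op]
  map_add' a b := by
    rw [CInftyRing.add_def, φ.map_op, CInftyRing.add_def]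
    congr 1; funext i; fin_cases i <;> rfl
  map_mul' a b := by
    rw [CInftyRing.mul_def, φ.map_op, CInftyRing.mul_def]
    congr 1; funext i; fin_cases i <;> rfl

end CInftyHom

/-! ### `ℝ`-points and germs -/

/-- An `ℝ`-point of `C`: a morphism of `C^∞`-rings `C → ℝ`, where `Φ_f = f` on `ℝ`. -/
@[ext]
structure RPoint (C : Type u) [CInftyRing C] where
  toFun : C → ℝ
  map_op : ∀ {n : ℕ} (f : SmoothFun n) (c : Fin n → C),
    toFun (CInftyRing.op f c) = f.1 fun i => toFun (c i)

namespace RPoint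

variable {C : Type u} [CInftyRing C]

instance : CoeFun (RPoint C) (fun _ => C → ℝ) := ⟨RPoint.toFun⟩

theorem map_mul (x : RPoint C) (a b : C) : x (a * b) = x a * x b :=
  x.map_op SmoothFun.mul ![a, b]

theorem map_one (x : RPoint C) : x 1 = 1 := x.map_op (SmoothFun.const 0 1) ![]

/-- The smallest topology on the set of `ℝ`-points for which every `x ↦ x c` is continuous. -/
instance : TopologicalSpace (RPoint C) :=
  ⨅ c : C, TopologicalSpace.induced (fun x : RPoint C => x c) inferInstance

theorem continuous_eval (c : C) : Continuous fun x : RPoint C => x c :=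
  continuous_iff_le_induced.2 (iInf_le _ c)

theorem prod_ne_zero (x : RPoint C) {n : ℕ} (d : Fin n → C) (h : ∀ i, x (d i) ≠ 0) :
    x (∏ i, d i) ≠ 0 := by
  induction n with
  | zero => simp [x.map_one]
  | succ n ih =>
    rw [Fin.prod_univ_succ, x.map_mul]
    exact mul_ne_zero (h 0) (ih _ fun i => h i.succ)

end RPoint

/-- Near a point `t₀ ≠ 0` the function `t ↦ 1 / t` is the restriction of a smooth function on `ℝ`:
there are smooth `k`, `w` with `w t₀ ≠ 0` and `w t * (t * k t) = w t` for all `t`. -/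
theorem SmoothFun.exists_local_inv {t₀ : ℝ} (h : t₀ ≠ 0) : ∃ k w : SmoothFun 1,
    w.1 (fun _ => t₀) ≠ 0 ∧ ∀ x, w.1 x * (x 0 * k.1 x) = w.1 x := by
  have hp : 0 < |t₀| := abs_pos.2 h
  let g : ContDiffBump t₀ := ⟨|t₀| / 3, |t₀| / 2, by positivity, by linarith⟩
  let b : ContDiffBump t₀ := ⟨|t₀| / 6, |t₀| / 3, by positivity, by linarith⟩
  have hk : ContDiff ℝ ∞ fun t : ℝ => g t / t := by
    rw [contDiff_iff_contDiffAt]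
    intro t
    by_cases ht : t = 0
    · subst ht
      have : (fun t : ℝ => g t / t) =ᶠ[nhds 0] fun _ => 0 := by
        have hm : Metric.ball (0 : ℝ) (|t₀| / 2) ∈ nhds (0 : ℝ) :=
          Metric.ball_mem_nhds _ (by positivity)
        filter_upwards [hm] with t ht
        have : g t = 0 := g.zero_of_le_dist (by
          rw [Metric.mem_ball, dist_zero_right, Real.norm_eq_abs] at ht
          rw [Real.dist_eq]
          have := abs_sub_abs_le_abs_sub t₀ t
          rw [abs_sub_comm] at this
          change |t₀| / 2 ≤ _
          linarith)
        simp [this]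
      exact contDiffAt_const.congr_of_eventuallyEq this
    · exact g.contDiff.contDiffAt.div contDiffAt_id ht
  refine ⟨⟨fun x => g (x 0) / x 0, hk.comp (proj 0).2⟩,
    ⟨fun x => b (x 0), b.contDiff.comp (proj 0).2⟩, ?_, ?_⟩
  · change b t₀ ≠ 0
    rw [b.one_of_mem_closedBall (Metric.mem_closedBall_self b.rIn_pos.le)]
    exact one_ne_zero
  · intro x
    change b (x 0) * (x 0 * (g (x 0) / x 0)) = b (x 0)
    by_cases hb : b (x 0) = 0
    · simp [hb]
    · have hd : dist (x 0) t₀ < |t₀| / 3 := by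
        by_contra hc
        exact hb (b.zero_of_le_dist (not_lt.1 hc))
      have hg : g (x 0) = 1 := g.one_of_mem_closedBall (Metric.mem_closedBall.2 hd.le)
      have hx : x 0 ≠ 0 := by
        intro h0
        rw [h0, dist_comm, dist_zero_right, Real.norm_eq_abs] at hd
        linarith
      rw [hg]; field_simp

/-- A local inverse of an element of a `C^∞`-ring not vanishing at the point `x`. -/
theorem CInftyRing.exists_local_inv {C : Type u} [CInftyRing C] (x : RPoint C) {d : C}
    (h : x d ≠ 0) : ∃ e w : C, x w ≠ 0 ∧ w * (d * e) = w := by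
  obtain ⟨k, w, hw, hkw⟩ := SmoothFun.exists_local_inv h
  refine ⟨op k ![d], op w ![d], ?_, ?_⟩
  · rw [x.map_op]
    convert hw using 2
    funext i; fin_cases i; rfl
  · have hd : d = op (SmoothFun.proj 0) ![d] := (op_proj 0 ![d]).symm
    have : d * op k ![d] = op (SmoothFun.mul.comp ![SmoothFun.proj 0, k]) ![d] := by
      rw [← op_mul_op, op_proj]; rfl
    rw [this, op_mul_op]
    exact op_ext hkw _

/-- If `d * c i = d * c' i` for all `i`, where `x d ≠ 0`, then `Φ_f c` and `Φ_f c'` also agree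
after multiplication by some `e` with `x e ≠ 0`. -/
theorem CInftyRing.op_germ_congr {C : Type u} [CInftyRing C] (x : RPoint C) {n : ℕ}
    (f : SmoothFun n) {c c' : Fin n → C} {d : C} (hd : x d ≠ 0)
    (h : ∀ i, d * c i = d * c' i) : ∃ e, x e ≠ 0 ∧ e * op f c = e * op f c' := by
  obtain ⟨k, w, hw, hkw⟩ := SmoothFun.exists_local_inv hd
  refine ⟨op w ![d], ?_, ?_⟩
  · rw [x.map_op]
    convert hw using 2
    funext i; fin_cases i; rfl
  -- `w(t) f(z) = w(t) f(t k(t) z)` identically, evaluated at `(d, c)`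
  have key : ∀ c : Fin n → C,
      op w ![d] * op f c = op w ![d] * op f fun i => op k ![d] * (d * c i) := by
    intro c
    let v : Fin (n + 1) → C := Fin.cons d c
    let t : SmoothFun (n + 1) := SmoothFun.proj 0
    let z : Fin n → SmoothFun (n + 1) := fun i => SmoothFun.proj i.succ
    have h0 : ∀ g : SmoothFun 1, op g ![d] = op (g.comp ![t]) v := by
      intro g
      rw [op_comp]; congr 1; funext i; fin_cases i
      exact (op_proj (0 : Fin (n + 1)) v).symm
    have ht : d = op t v := (op_proj (0 : Fin (n + 1)) v).symm
    have hz : ∀ i, c i = op (z i) v := fun i => (op_proj i.succ v).symm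
    have hr : (fun i => op k ![d] * (d * c i)) =
        fun i => op (SmoothFun.mul.comp ![k.comp ![t], SmoothFun.mul.comp ![t, z i]]) v := by
      funext i
      rw [← op_mul_op, ← op_mul_op, ← h0, ← ht, ← hz]
    have hl : op f c = op (f.comp z) v := by
      rw [op_comp]; congr 1; funext i; exact hz i
    rw [hr, hl, ← op_comp, h0, op_mul_op, op_mul_op]
    refine op_ext (fun y => ?_) v
    change w.1 _ * f.1 _ = w.1 _ * f.1 _
    by_cases hy : w.1 (fun i => (![t] i).1 y) = 0
    · rw [hy, zero_mul, zero_mul]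
    · refine congrArg _ (congrArg f.1 (funext fun i => ?_))
      have := hkw fun i => (![t] i).1 y
      have h1 : y 0 * k.1 (fun i => (![t] i).1 y) = 1 :=
        mul_left_cancel₀ hy (this.trans (mul_one _).symm)
      change y i.succ = k.1 (fun i => (![t] i).1 y) * (y 0 * y i.succ)
      linear_combination (-(y i.succ)) * h1
  rw [key c, key c']
  simp only [h]

/-- Two elements of `C` have the same germ at `x` if they agree after multiplication by some `d`
with `x d ≠ 0`. -/
def germSetoid {C : Type u} [CInftyRing C] (x : RPoint C) : Setoid C where
  r c c' := ∃ d, x d ≠ 0 ∧ d * c = d * c'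
  iseqv :=
    { refl := fun _ => ⟨1, by simp [x.map_one], rfl⟩
      symm := fun ⟨d, hd, h⟩ => ⟨d, hd, h.symm⟩
      trans := fun {a b c} ⟨d, hd, h⟩ ⟨e, he, h'⟩ => ⟨d * e, by
        rw [x.map_mul]; exact mul_ne_zero hd he, by
        calc d * e * a = e * (d * a) := by ring
          _ = d * (e * b) := by rw [h]; ring
          _ = d * e * c := by rw [h']; ring⟩ }

/-- The localization `C_x` of `C` at the elements not vanishing at the `ℝ`-point `x`, constructed
as a quotient of `C`; see `GermRing.isLocalization` for the universal property. -/
def GermRing {C : Type u} [CInftyRing C] (x : RPoint C) : Type u := Quotient (germSetoid x)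

namespace GermRing

variable {C : Type u} [CInftyRing C] (x : RPoint C)

/-- The class of `c` in `C_x`. -/
def mk (c : C) : GermRing x := Quotient.mk (germSetoid x) c

theorem mk_eq_mk {c c' : C} : mk x c = mk x c' ↔ ∃ d, x d ≠ 0 ∧ d * c = d * c' := Quotient.eq

theorem mk_surjective : Function.Surjective (mk x) := Quotient.mk_surjective

theorem exists_lift {n : ℕ} (s : Fin n → GermRing x) : ∃ c : Fin n → C, s = fun i => mk x (c i) :=
  ⟨fun i => (mk_surjective x (s i)).choose,
    funext fun i => (mk_surjective x (s i)).choose_spec.symm⟩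

/-- The operation on `C_x` induced by `Φ_f` on `C`. -/
noncomputable def opAux {n : ℕ} (f : SmoothFun n) (s : Fin n → GermRing x) : GermRing x :=
  mk x (CInftyRing.op f (exists_lift x s).choose)

theorem opAux_mk {n : ℕ} (f : SmoothFun n) (c : Fin n → C) :
    opAux x f (fun i => mk x (c i)) = mk x (CInftyRing.op f c) := by
  have h := (exists_lift x fun i => mk x (c i)).choose_spec
  have h' : ∀ i, ∃ d, x d ≠ 0 ∧ d * c i = d * (exists_lift x fun i => mk x (c i)).choose i :=
    fun i => (mk_eq_mk x).1 (congrFun h i)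
  choose d hd hdc using h'
  obtain ⟨e, he, hec⟩ := CInftyRing.op_germ_congr x f (d := ∏ i, d i) (x.prod_ne_zero d hd)
    (c := c) (c' := (exists_lift x fun i => mk x (c i)).choose) (fun i => by
      obtain ⟨r, hr⟩ := Finset.dvd_prod_of_mem d (Finset.mem_univ i)
      rw [hr]
      linear_combination r * hdc i)
  exact (mk_eq_mk x).2 ⟨e, he, hec.symm⟩

noncomputable instance : CInftyRing (GermRing x) where
  op := opAux x
  op_comp g f s := by
    obtain ⟨c, rfl⟩ := exists_lift x s
    simp only [opAux_mk, CInftyRing.op_comp]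
  op_proj j s := by
    obtain ⟨c, rfl⟩ := exists_lift x s
    rw [opAux_mk, CInftyRing.op_proj]

/-- The projection `π_x : C → C_x`. -/
noncomputable def π : CInftyHom C (GermRing x) where
  toFun := mk x
  map_op f c := (opAux_mk x f c).symm

noncomputable instance : Algebra C (GermRing x) := (π x).toRingHom.toAlgebra

theorem algebraMap_def (c : C) : algebraMap C (GermRing x) c = mk x c := rfl

theorem algebraMap_eq {c c' : C} : algebraMap C (GermRing x) c = algebraMap C (GermRing x) c' ↔
    ∃ d, x d ≠ 0 ∧ d * c = d * c' := mk_eq_mk x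

theorem isUnit_algebraMap {d : C} (h : x d ≠ 0) : IsUnit (algebraMap C (GermRing x) d) := by
  obtain ⟨e, w, hw, hwd⟩ := CInftyRing.exists_local_inv x h
  refine IsUnit.of_mul_eq_one (algebraMap C _ e) ?_
  rw [← map_mul, ← map_one (algebraMap C (GermRing x)), algebraMap_eq]
  exact ⟨w, hw, by rw [hwd, mul_one]⟩

/-- `C_x` is the localization of `C` at `{s | x s ≠ 0}` in the category of `C^∞`-rings. -/
theorem isLocalization : (∀ s : C, x s ≠ 0 → IsUnit ((π x).toFun s)) ∧
    ∀ (E : Type v) [CInftyRing E] (φ : CInftyHom C E), (∀ s : C, x s ≠ 0 → IsUnit (φ.toFun s)) →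
      ∃! ψ : CInftyHom (GermRing x) E, ∀ c, ψ.toFun ((π x).toFun c) = φ.toFun c := by
  refine ⟨fun s hs => isUnit_algebraMap x hs, fun E _ φ hφ => ?_⟩
  have hl : ∀ a b : C, (germSetoid x).r a b → φ.toFun a = φ.toFun b := by
    rintro a b ⟨d, hd, h⟩
    have := congrArg φ.toRingHom h
    rw [map_mul, map_mul] at this
    exact (hφ d hd).mul_left_cancel this
  refine ⟨⟨Quotient.lift φ.toFun hl, fun f s => ?_⟩, fun c => rfl, ?_⟩
  · obtain ⟨c, rfl⟩ := exists_lift x s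
    change Quotient.lift φ.toFun hl (opAux x f _) = _
    rw [opAux_mk]
    exact φ.map_op f c
  · rintro ⟨ψ, hψ⟩ h
    congr 1
    funext s
    obtain ⟨c, rfl⟩ := mk_surjective x s
    exact h c

end GermRing

/-- `C` is fair: finitely generated, and an element with vanishing germ at every `ℝ`-point is
zero. -/
def CInftyRing.IsFair (C : Type u) [CInftyRing C] : Prop :=
  CInftyRing.IsFinitelyGenerated C ∧
    ∀ c : C, (∀ x : RPoint C, algebraMap C (GermRing x) c = 0) → c = 0

/-! ### The spectrum -/

namespace CSpec

variable (C : Type u) [CInftyRing C]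

/-- The topological space `X` underlying `Spec C`. -/
abbrev space : TopCat.{u} := TopCat.of (RPoint C)

/-- The functions `s : U → ∐ C_x` of the form `s x = π_x(c) π_x(d)⁻¹` with fixed `c, d ∈ C`, where
`x d ≠ 0` for all `x ∈ U`. -/
def isFraction : TopCat.PrelocalPredicate fun x : space C => GermRing (C := C) x where
  pred {U} s := ∃ c d : C, ∀ x : U, x.1 d ≠ 0 ∧
    s x * algebraMap C (GermRing x.1) d = algebraMap C (GermRing x.1) c
  res := by
    rintro U V i s ⟨c, d, h⟩
    exact ⟨c, d, fun x => h ⟨x.1, i.le x.2⟩⟩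

/-- The functions `s : U → ∐ C_x` that are locally fractions. -/
def isLocallyFraction : TopCat.LocalPredicate fun x : space C => GermRing (C := C) x :=
  (isFraction C).sheafify

variable {C}

/-- The sections `O_X(U)` of the structure sheaf of `Spec C` over `U`. -/
def Sec (U : Opens (space C)) : Type u :=
  {s : ∀ x : U, GermRing (C := C) x.1 // (isLocallyFraction C).pred s}

/-- Sections are locally given by elements of `C`. -/
theorem Sec.exists_local {U : Opens (space C)} (s : Sec U) (x : U) :
    ∃ (V : Opens (space C)) (_ : x.1 ∈ V) (i : V ≤ U) (c : C),
      ∀ y : V, s.1 ⟨y.1, i y.2⟩ = algebraMap C (GermRing y.1) c := by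
  obtain ⟨V, hxV, i, c, d, h⟩ := s.2 x
  obtain ⟨e, w, hw, hwd⟩ := CInftyRing.exists_local_inv x.1 (h ⟨x.1, hxV⟩).1
  let W : Opens (space C) :=
    ⟨{y : RPoint C | y w ≠ 0}, isOpen_ne_fun (RPoint.continuous_eval w) continuous_const⟩
  refine ⟨V ⊓ W, ⟨hxV, hw⟩, inf_le_left.trans i.le, c * e, fun y => ?_⟩
  have hy := (h ⟨y.1, y.2.1⟩).2
  have hde : algebraMap C (GermRing y.1) (d * e) = 1 := by
    rw [← map_one (algebraMap C (GermRing y.1)), GermRing.algebraMap_eq]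
    exact ⟨w, y.2.2, by rw [hwd, mul_one]⟩
  rw [map_mul] at hde
  rw [map_mul, ← hy, mul_assoc, hde, mul_one]
  rfl

/-- A function that is locally given by elements of `C` is a section. -/
theorem pred_of_local {U : Opens (space C)} (s : ∀ x : U, GermRing (C := C) x.1)
    (h : ∀ x : U, ∃ (V : Opens (space C)) (_ : x.1 ∈ V) (i : V ≤ U) (c : C),
      ∀ y : V, s ⟨y.1, i y.2⟩ = algebraMap C (GermRing y.1) c) : (isLocallyFraction C).pred s := by
  intro x
  obtain ⟨V, hxV, i, c, hc⟩ := h x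
  refine ⟨V, hxV, homOfLE i, c, 1, fun y => ⟨by simp [RPoint.map_one], ?_⟩⟩
  rw [map_one, mul_one]
  exact hc y

/-- `O_X(U)` is a `C^∞`-ring, with operations defined pointwise. -/
noncomputable instance (U : Opens (space C)) : CInftyRing (Sec U) where
  op {n} f s := ⟨fun x => CInftyRing.op f fun i => (s i).1 x, by
    apply pred_of_local
    intro x
    choose V hV i c hc using fun j => Sec.exists_local (s j) x
    let W : Opens (space C) := ⟨⋂ j, (V j : Set (RPoint C)), isOpen_iInter_of_finite fun j => (V j).2⟩
    have hW : ∀ j, W ≤ V j := fun j => Set.iInter_subset _ j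
    refine ⟨W ⊓ U, ⟨Set.mem_iInter.2 hV, x.2⟩, inf_le_right, CInftyRing.op f c, fun y => ?_⟩
    refine Eq.trans ?_ ((GermRing.π y.1).map_op f c).symm
    congr 1
    funext j
    exact hc j ⟨y.1, hW j y.2.1⟩⟩
  op_comp g f s := Subtype.ext (funext fun x => CInftyRing.op_comp g f fun i => (s i).1 x)
  op_proj j s := Subtype.ext (funext fun x => CInftyRing.op_proj j fun i => (s i).1 x)

/-- The restriction map `ρ_{UV} : O_X(U) → O_X(V)` for `V ⊆ U`. -/
noncomputable def res {U V : Opens (space C)} (i : V ⟶ U) : CInftyHom (Sec U) (Sec V) where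
  toFun s := ⟨fun x => s.1 ⟨x.1, i.le x.2⟩, (isLocallyFraction C).res i s.1 s.2⟩
  map_op _ _ := rfl

/-- The morphism `C → O_X(U)`, mapping `c` to `x ↦ π_x(c)`. For `U = X` it is `Φ_C`. -/
noncomputable def toSec (U : Opens (space C)) : CInftyHom C (Sec U) where
  toFun c := ⟨fun x => algebraMap C (GermRing x.1) c,
    pred_of_local _ fun x => ⟨U, x.2, le_rfl, c, fun _ => rfl⟩⟩
  map_op f c := Subtype.ext (funext fun x => (GermRing.π x.1).map_op f c)

variable (C) in
/-- The structure presheaf, with values in rings. -/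
noncomputable def structurePresheaf : TopCat.Presheaf RingCat.{u} (space C) where
  obj U := RingCat.of (Sec U.unop)
  map i := RingCat.ofHom (res i.unop).toRingHom
  map_id _ := RingCat.hom_ext (RingHom.ext fun _ => rfl)
  map_comp _ _ := RingCat.hom_ext (RingHom.ext fun _ => rfl)

variable (C) in
/-- The structure sheaf `O_X` of `X = Spec C`, as a sheaf of rings. -/
noncomputable def structureSheaf : Sheaf (Opens.grothendieckTopology (space C)) RingCat.{u} where
  obj := structurePresheaf C
  property := (TopCat.Presheaf.isSheaf_iff_isSheaf_comp (forget RingCat) _).2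
    (TopCat.Presheaf.isSheaf_of_iso
      (NatIso.ofComponents (fun _ => Iso.refl _) fun _ => rfl :
        (TopCat.subsheafToTypes (isLocallyFraction C)).obj ≅ structurePresheaf C ⋙ forget RingCat)
      (TopCat.subsheafToTypes (isLocallyFraction C)).2)

end CSpec

/-! ### Modules over a `C^∞`-ring -/

namespace CInftyModule

variable (C : Type u) [CInftyRing C] {M : Type v} [AddCommGroup M] [Module C M]

/-- The map `id_M ⊗ π_x : M → M ⊗_C C_x`. -/
noncomputable def germ (x : RPoint C) : M →ₗ[C] M ⊗[C] GermRing x :=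
  (TensorProduct.mk C M (GermRing x)).flip 1

/-- `∑ a, m a` is a locally finite sum: the spectrum of `C` is covered by open sets `U` such that
for all but finitely many `a` the germ of `m a` vanishes at all points of `U`. -/
def IsLocallyFiniteSum {A : Type*} (m : A → M) : Prop :=
  ∀ x : RPoint C, ∃ U : Set (RPoint C), IsOpen U ∧ x ∈ U ∧
    {a | ¬ ∀ y ∈ U, germ C y (m a) = 0}.Finite

/-- `l` is a limit of the locally finite sum `∑ a, m a`: at each `x`, the germ of `l` is the sum of
the finitely many nonzero germs of the `m a`. -/
def IsLimit {A : Type*} (m : A → M) (l : M) : Prop :=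
  ∀ x : RPoint C, germ C x l = ∑ᶠ a, germ C x (m a)

variable (M) in
/-- `M` is complete: every locally finite sum in `M` has a unique limit. -/
def IsComplete : Prop :=
  ∀ (A : Type u) (m : A → M), IsLocallyFiniteSum C m → ∃! l, IsLimit C m l

end CInftyModule

/-- The full subcategory of complete `C`-modules, as a property of objects. -/
def completeModules (C : Type u) [CInftyRing C] : ObjectProperty (ModuleCat.{u} C) :=
  fun M => CInftyModule.IsComplete C M

namespace CSpec

variable {C : Type u} [CInftyRing C]

noncomputable instance (U : Opens (space C)) : Algebra C (Sec U) := (toSec U).toRingHom.toAlgebra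

/-- The restriction map, as a morphism of `C`-algebras. -/
noncomputable def resAlgHom {U V : Opens (space C)} (i : V ⟶ U) : Sec U →ₐ[C] Sec V where
  toRingHom := (res i).toRingHom
  commutes' _ := rfl

/-- The functor `M ↦ O_X(U) ⊗_C M` from `C`-modules to `O_X(U)`-modules. -/
noncomputable def baseChange (U : Opens (space C)) : ModuleCat.{u} C ⥤ ModuleCat.{u} (Sec U) where
  obj M := ModuleCat.of (Sec U) (Sec U ⊗[C] M)
  map f := ModuleCat.ofHom (f.hom.baseChange (Sec U))
  map_id M := by ext x; simp
  map_comp f g := by ext x; simp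

section

variable {U V W : Opens (space C)} (M : Type u) [AddCommGroup M] [Module C M]

/-- The map `ρ_{UV} ⊗ id_M`. -/
noncomputable def tensorRes (i : V ⟶ U) : Sec U ⊗[C] M →ₗ[C] Sec V ⊗[C] M :=
  TensorProduct.map (resAlgHom i).toLinearMap LinearMap.id

theorem tensorRes_smul (i : V ⟶ U) (r : Sec U) (t : Sec U ⊗[C] M) :
    tensorRes M i (r • t) = resAlgHom i r • tensorRes M i t := by
  induction t with
  | zero => simp
  | tmul s m => simp [tensorRes, TensorProduct.smul_tmul']
  | add a b ha hb => rw [smul_add, map_add, ha, hb, map_add, smul_add]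

theorem tensorRes_id (t : Sec U ⊗[C] M) : tensorRes M (𝟙 U) t = t := by
  induction t with
  | zero => simp
  | tmul s m => rfl
  | add a b ha hb => rw [map_add, ha, hb]

theorem tensorRes_comp (i : V ⟶ U) (j : W ⟶ V) (t : Sec U ⊗[C] M) :
    tensorRes M (j ≫ i) t = tensorRes M j (tensorRes M i t) := by
  induction t with
  | zero => simp
  | tmul s m => rfl
  | add a b ha hb => rw [map_add, ha, hb, map_add, map_add]

end

/-- The presheaf of `O_X`-modules `U ↦ O_X(U) ⊗_C M`. -/
noncomputable def tensorObj (M : ModuleCat.{u} C) :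
    PresheafOfModules.{u} (structurePresheaf C) where
  obj U := (baseChange U.unop).obj M
  map {_ V} i := ModuleCat.ofHom
    (X := (baseChange _).obj M)
    (Y := (ModuleCat.restrictScalars (resAlgHom i.unop).toRingHom).obj ((baseChange V.unop).obj M))
    { toFun := tensorRes M i.unop
      map_add' := map_add _
      map_smul' := tensorRes_smul M i.unop }
  map_id _ := ModuleCat.hom_ext (LinearMap.ext fun t => tensorRes_id M t)
  map_comp i j := ModuleCat.hom_ext (LinearMap.ext fun t => tensorRes_comp M i.unop j.unop t)

variable (C) in
/-- The functor from `C`-modules to presheaves of `O_X`-modules with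
`M ↦ (U ↦ O_X(U) ⊗_C M)`. -/
noncomputable def tensorPresheaf : ModuleCat.{u} C ⥤ PresheafOfModules.{u} (structurePresheaf C) where
  obj := tensorObj
  map f :=
    { app := fun U => (baseChange U.unop).map f
      naturality := fun _ => ModuleCat.hom_ext (LinearMap.ext fun t => by
        change (f.hom.baseChange (Sec _)) (tensorRes _ _ t) =
          tensorRes _ _ (f.hom.baseChange (Sec _) t)
        induction (show Sec _ ⊗[C] _ from t) with
        | zero => simp
        | tmul s m => rfl
        | add a b ha hb => simp only [map_add, ha, hb]) }
  map_id M := PresheafOfModules.hom_ext fun U => (baseChange U.unop).map_id M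
  map_comp f g := PresheafOfModules.hom_ext fun U => (baseChange U.unop).map_comp f g

variable (C) in
/-- The category of `O_X`-modules, for `X = Spec C`. -/
abbrev OMod := SheafOfModules.{u} (structureSheaf C)

/-- Sheafification of presheaves of modules over a sheaf of rings on a topological space. -/
noncomputable def sheafifyModules {X : TopCat.{u}}
    (R : Sheaf (Opens.grothendieckTopology X) RingCat.{u}) :
    PresheafOfModules.{u} R.obj ⥤ SheafOfModules.{u} R :=
  PresheafOfModules.sheafification (𝟙 R.obj)

/-- Sheafification is left adjoint to the inclusion of sheaves into presheaves. -/
noncomputable def sheafifyAdj {X : TopCat.{u}}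
    (R : Sheaf (Opens.grothendieckTopology X) RingCat.{u}) :
    sheafifyModules R ⊣ SheafOfModules.forget R :=
  PresheafOfModules.sheafificationAdjunction (𝟙 R.obj)

variable (C) in
/-- The functor `MSpec` from `C`-modules to `O_X`-modules: `MSpec M` is the sheafification of the
presheaf `U ↦ O_X(U) ⊗_C M`. -/
noncomputable def MSpec : ModuleCat.{u} C ⥤ OMod C :=
  (tensorPresheaf C : ModuleCat.{u} C ⥤ PresheafOfModules.{u} (structureSheaf C).obj) ⋙
    sheafifyModules (structureSheaf C)

variable (C) in
/-- Global sections of a presheaf of `O_X`-modules, as a `C`-module via `Φ_C : C → O_X(X)`. -/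
noncomputable def presheafΓ : PresheafOfModules.{u} (structurePresheaf C) ⥤ ModuleCat.{u} C :=
  PresheafOfModules.evaluation (structurePresheaf C) (op ⊤) ⋙
    ModuleCat.restrictScalars (toSec (⊤ : Opens (space C))).toRingHom

variable (C) in
/-- The global sections functor `Γ` from `O_X`-modules to `C`-modules. -/
noncomputable def Γ : OMod C ⥤ ModuleCat.{u} C :=
  SheafOfModules.forget (structureSheaf C) ⋙ presheafΓ C

/-- The functor `E ↦ E(U)` from `O_X`-modules to `O_X(U)`-modules. -/
noncomputable def sectionsFunctor (U : Opens (space C)) : OMod C ⥤ ModuleCat.{u} (Sec U) :=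
  SheafOfModules.evaluation (structureSheaf C) (op U)

/-- The canonical map `O_X(U) ⊗_C M → (MSpec M)(U)` from the presheaf to its sheafification,
natural in `M`. -/
noncomputable def toSections (U : Opens (space C)) :
    baseChange U ⟶ MSpec C ⋙ sectionsFunctor U where
  app M := ((sheafifyAdj (structureSheaf C)).unit.app ((tensorPresheaf C).obj M)).app (op U)
  naturality _ _ f := congrArg (fun φ => PresheafOfModules.Hom.app φ (op U))
    ((sheafifyAdj (structureSheaf C)).unit.naturality ((tensorPresheaf C).map f))

/-- The map `M → E(U)`, `m ↦ g(m)|_U`, for `g : M → E(X)`. -/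
noncomputable def liftAux {M : ModuleCat.{u} C}
    {E : PresheafOfModules.{u} (structurePresheaf C)} (g : M ⟶ (presheafΓ C).obj E)
    (U : Opens (space C)) :
    M ⟶ (ModuleCat.restrictScalars (algebraMap C (Sec U))).obj
      (show ModuleCat.{u} (Sec U) from E.obj (op U)) :=
  ModuleCat.ofHom
    (Y := (ModuleCat.restrictScalars (algebraMap C (Sec U))).obj
      (show ModuleCat.{u} (Sec U) from E.obj (op U)))
    { toFun := fun m => E.map (homOfLE (le_top : U ≤ ⊤)).op (g m)
      map_add' := fun a b => by
        exact (congrArg (E.map (homOfLE (le_top : U ≤ ⊤)).op) (map_add g.hom a b)).trans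
          (map_add (E.map (homOfLE (le_top : U ≤ ⊤)).op).hom (g a) (g b))
      map_smul' := fun c a => by
        exact (congrArg (E.map (homOfLE (le_top : U ≤ ⊤)).op) (map_smul g.hom c a)).trans
          (E.map_smul (homOfLE (le_top : U ≤ ⊤)).op ((toSec ⊤).toFun c) (g a)) }

/-- The `B`-linear map `B ⊗_A M → N`, `b ⊗ m ↦ b • g m`, for `A`-linear `g : M → N`. -/
noncomputable def liftTensor {A B : Type u} [CommRing A] [CommRing B] [Algebra A B]
    {M : ModuleCat.{u} A} {N : ModuleCat.{u} B}
    (g : M ⟶ (ModuleCat.restrictScalars (algebraMap A B)).obj N) :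
    ModuleCat.of B (B ⊗[A] M) ⟶ N :=
  letI : Module A N := Module.compHom N (algebraMap A B)
  haveI : IsScalarTower A B N := IsScalarTower.of_algebraMap_smul fun _ _ => rfl
  ModuleCat.ofHom (LinearMap.liftBaseChange B (show M →ₗ[A] N from g.hom))

theorem liftTensor_tmul {A B : Type u} [CommRing A] [CommRing B] [Algebra A B]
    {M : ModuleCat.{u} A} {N : ModuleCat.{u} B}
    (g : M ⟶ (ModuleCat.restrictScalars (algebraMap A B)).obj N) (b : B) (m : M) :
    liftTensor g (b ⊗ₜ[A] m) = b • (show N from g m) := by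
  let : Module A N := Module.compHom N (algebraMap A B)
  have : IsScalarTower A B N := IsScalarTower.of_algebraMap_smul fun _ _ => rfl
  exact LinearMap.liftBaseChange_tmul (A := B) (show M →ₗ[A] N from g.hom) b m

/-- The adjoint `O_X(U) ⊗_C M → E(U)`, `s ⊗ m ↦ s • g(m)|_U` of `g : M → E(X)`. -/
noncomputable def liftPresheaf {M : ModuleCat.{u} C}
    {E : PresheafOfModules.{u} (structurePresheaf C)}
    (g : M ⟶ (presheafΓ C).obj E) : (tensorPresheaf C).obj M ⟶ E where
  app U := liftTensor (liftAux g U.unop)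
  naturality {U V} i := by
    refine ModuleCat.hom_ext (LinearMap.ext fun (t : Sec U.unop ⊗[C] M) => ?_)
    change liftTensor (liftAux g V.unop) (tensorRes M i.unop t) =
      E.map i (liftTensor (liftAux g U.unop) t)
    induction t with
    | zero =>
      rw [map_zero]
      refine (map_zero (liftTensor (liftAux g V.unop)).hom).trans ?_
      refine (map_zero (E.map i).hom).symm.trans (congrArg (E.map i) ?_)
      exact (map_zero (liftTensor (liftAux g U.unop)).hom).symm
    | tmul s m =>
      refine (liftTensor_tmul (liftAux g V.unop) (resAlgHom i.unop s) m).trans ?_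
      refine Eq.trans ?_ (congrArg (E.map i) (liftTensor_tmul (liftAux g U.unop) s m)).symm
      refine Eq.trans ?_ (E.map_smul i s _).symm
      exact congrArg (resAlgHom i.unop s • ·) (E.map_comp_apply _ i (g m))
    | add a b ha hb =>
      rw [map_add]
      refine (map_add (liftTensor (liftAux g V.unop)).hom _ _).trans ?_
      refine (congrArg₂ (· + ·) ha hb).trans ((map_add (E.map i).hom _ _).symm.trans ?_)
      exact congrArg (E.map i) (map_add (liftTensor (liftAux g U.unop)).hom a b).symm

/-- The map `M → O_X(X) ⊗_C M`, `m ↦ 1 ⊗ m`. -/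
noncomputable def presheafUnit (M : ModuleCat.{u} C) :
    M ⟶ (presheafΓ C).obj ((tensorPresheaf C).obj M) :=
  ModuleCat.ofHom
    (Y := (ModuleCat.restrictScalars (algebraMap C (Sec (⊤ : Opens (space C))))).obj
      (ModuleCat.of (Sec (⊤ : Opens (space C))) (Sec (⊤ : Opens (space C)) ⊗[C] M)))
    { toFun := fun m => (1 : Sec (⊤ : Opens (space C))) ⊗ₜ[C] m
      map_add' := fun a b => TensorProduct.tmul_add _ a b
      map_smul' := fun c a => by
        change (1 : Sec (⊤ : Opens (space C))) ⊗ₜ[C] (c • a) =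
          algebraMap C (Sec (⊤ : Opens (space C))) c • (1 : Sec (⊤ : Opens (space C))) ⊗ₜ[C] a
        rw [TensorProduct.tmul_smul, algebraMap_smul] }

theorem presheafHom_ext {M : ModuleCat.{u} C} {E : PresheafOfModules.{u} (structurePresheaf C)}
    {α β : (tensorPresheaf C).obj M ⟶ E}
    (h : ∀ m, α.app (op ⊤) (presheafUnit M m) = β.app (op ⊤) (presheafUnit M m)) : α = β := by
  refine PresheafOfModules.hom_ext fun U => ModuleCat.hom_ext
    (LinearMap.ext fun (t : Sec U.unop ⊗[C] M) => ?_)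
  change α.app U t = β.app U t
  induction t with
  | zero => exact (map_zero (α.app U).hom).trans (map_zero (β.app U).hom).symm
  | tmul s m =>
    let F : ModuleCat.{u} (Sec U.unop) := E.obj U
    let ρ : E.obj (op ⊤) → F := fun e => E.map (homOfLE (le_top : U.unop ≤ ⊤)).op e
    have key : ∀ γ : (tensorPresheaf C).obj M ⟶ E, (γ.app U (s ⊗ₜ[C] m) : F) =
        s • ρ (γ.app (op ⊤) (presheafUnit M m)) := by
      intro γ
      have h1 : s ⊗ₜ[C] m = s • tensorRes M (homOfLE (le_top : U.unop ≤ ⊤)) (1 ⊗ₜ[C] m) := by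
        rw [tensorRes, TensorProduct.map_tmul, TensorProduct.smul_tmul']
        change _ = (s * resAlgHom (homOfLE (le_top : U.unop ≤ ⊤)) 1) ⊗ₜ[C] m
        rw [map_one, mul_one]
      rw [h1]
      let γ' : (Sec U.unop ⊗[C] M) →ₗ[Sec U.unop] F := (γ.app U).hom
      refine (map_smul γ' s _).trans (congrArg (fun e : F => s • e) ?_)
      exact PresheafOfModules.naturality_apply γ (homOfLE (le_top : U.unop ≤ ⊤)).op
        (presheafUnit M m)
    exact (key α).trans ((congrArg (fun e => s • ρ e) (h m)).trans
      (key β).symm)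
  | add a b ha hb =>
    exact (map_add (α.app U).hom a b).trans
      ((congrArg₂ (· + ·) ha hb).trans (map_add (β.app U).hom a b).symm)

theorem liftPresheaf_unit {M : ModuleCat.{u} C} {E : PresheafOfModules.{u} (structurePresheaf C)}
    (g : M ⟶ (presheafΓ C).obj E) (m : M) :
    (liftPresheaf g).app (op ⊤) (presheafUnit M m) = g m := by
  refine (liftTensor_tmul (liftAux g ⊤) 1 m).trans ((one_smul _ _).trans ?_)
  exact congrArg (fun φ => φ.hom (g m)) (E.map_id (op ⊤))

variable (C) in
/-- The adjunction between `M ↦ (U ↦ O_X(U) ⊗_C M)` and global sections of presheaves. -/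
noncomputable def presheafAdj : tensorPresheaf C ⊣ presheafΓ C :=
  Adjunction.mkOfHomEquiv
    { homEquiv := fun M _ =>
        { toFun := fun φ => presheafUnit M ≫ (presheafΓ C).map φ
          invFun := fun g => liftPresheaf g
          left_inv := fun φ => presheafHom_ext fun m =>
            liftPresheaf_unit (presheafUnit M ≫ (presheafΓ C).map φ) m
          right_inv := fun g => ModuleCat.hom_ext (LinearMap.ext fun m => liftPresheaf_unit g m) }
      homEquiv_naturality_left_symm := fun f g => presheafHom_ext fun m =>
        (liftPresheaf_unit (f ≫ g) m).trans (liftPresheaf_unit g (f m)).symm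
      homEquiv_naturality_right := fun _ _ => rfl }

variable (C) in
/-- `MSpec` is left adjoint to `Γ`. -/
noncomputable def adj : MSpec C ⊣ Γ C :=
  (presheafAdj C).comp (sheafifyAdj (structureSheaf C))

end CSpec

/-! Everything is reduced to germs. The germ of a module element at `x` vanishes exactly when some
function not vanishing at `x` kills the element, so equality of germs is an open condition. In the
presence of partitions of unity, completeness amounts to two sheaf-like conditions: an element with
zero germs is zero, and a family of germs locally given by elements is given by one element
(`isComplete_of_glue`, `HasPartitions.germsGlue`).

A linear map bijective on germs cannot be told apart from an isomorphism by complete modules: maps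
to a complete module extend along it uniquely (`GermBijective.exists_extension`,
`GermBijective.hom_ext`), and it is bijective once its source is complete and its target separated
(`GermBijective.bijective`). Hence a germwise bijective map to a complete module is a reflection.

For an `O_X`-module, the algebraic germ of a section vanishes if and only if the section is zero
near the point (`OMod.germ_eq_zero_iff_restr`): functions not vanishing at a point are invertible
nearby, and bump functions give the converse. So modules of sections are complete. Sheafification
changes nothing locally, and sections of `O_X` are locally elements of `C`; therefore `M → Γ(MSpec
M)` and `O_X(U) ⊗ M → (MSpec M)(U)` are germwise bijective. The counit is an isomorphism because
sections are locally restrictions of global ones. This yields the equivalence, and through it the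
existence of the reflection. For finitely presented `M` the base change is itself complete, being a
cokernel of a map between finite powers of the complete module `O_X(U)`.

The only geometric input is `IsEmbeddable`: finitely many elements embed the points as a closed
subset of some `ℝᵐ`, from which smooth partitions of unity are pulled back. It follows from finite
generation and passes from `C` to `O_X(U)`, whose points are those of `U`. Thus the whole argument
can be run with `O_X(U)` in place of `C`. -/

/-! ### Germs of module elements -/

namespace RPoint

variable {D : Type u} [CInftyRing D]

/-- The multiplicative set of elements not vanishing at an `ℝ`-point. -/
def nonvanishing (x : RPoint D) : Submonoid D where
  carrier := {d | x d ≠ 0}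
  one_mem' := by simp [x.map_one]
  mul_mem' {a b} ha hb := by
    change x (a * b) ≠ 0
    rw [x.map_mul]
    exact mul_ne_zero ha hb

theorem isOpen_ne_zero (d : D) : IsOpen {x : RPoint D | x d ≠ 0} :=
  isOpen_ne_fun (RPoint.continuous_eval d) continuous_const

/-- The `C^∞`-localization is also the algebraic one: smooth local inverses already lie in `D`, so
the quotient `GermRing x` needs no denominators. This makes `M ⊗ C_x` a localized module, with the
usual criterion for vanishing. -/
instance (x : RPoint D) : IsLocalization x.nonvanishing (GermRing x) where
  map_units d := GermRing.isUnit_algebraMap x d.2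
  surj z := by
    obtain ⟨c, rfl⟩ := GermRing.mk_surjective x z
    exact ⟨(c, 1), (congrArg (GermRing.mk x c * ·) (_root_.map_one _)).trans (mul_one _)⟩
  exists_of_eq {a b} h := by
    obtain ⟨d, hd, h⟩ := (GermRing.algebraMap_eq x).1 h
    exact ⟨⟨d, hd⟩, h⟩

end RPoint

theorem GermRing.algebraMap_surjective {D : Type u} [CInftyRing D] (x : RPoint D) :
    Function.Surjective (algebraMap D (GermRing x)) := GermRing.mk_surjective x

theorem GermRing.algebraMap_eq_zero {D : Type u} [CInftyRing D] {x : RPoint D} {c : D} :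
    algebraMap D (GermRing x) c = 0 ↔ ∃ d, x d ≠ 0 ∧ d * c = 0 := by
  rw [← map_zero (algebraMap D (GermRing x)), GermRing.algebraMap_eq]
  simp

namespace CInftyModule

section Germs

variable {D : Type u} [CInftyRing D] {N : Type v} [AddCommGroup N] [Module D N]
  {P : Type v} [AddCommGroup P] [Module D P]

theorem germ_eq_zero_iff {x : RPoint D} {n : N} :
    germ D x n = 0 ↔ ∃ d : D, x d ≠ 0 ∧ d • n = 0 := by
  have h : germ D x n = 0 ↔ TensorProduct.mk D (GermRing x) N 1 n = 0 := by
    rw [← (TensorProduct.comm D N (GermRing x)).map_eq_zero_iff]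
    rfl
  rw [h, IsLocalizedModule.eq_zero_iff x.nonvanishing]
  exact ⟨fun ⟨d, hd⟩ => ⟨d, d.2, hd⟩, fun ⟨d, hd, h⟩ => ⟨⟨d, hd⟩, h⟩⟩

theorem germ_surjective (x : RPoint D) : Function.Surjective (germ D x : N →ₗ[D] _) := by
  intro t
  induction t with
  | zero => exact ⟨0, map_zero _⟩
  | tmul n z =>
    obtain ⟨c, rfl⟩ := GermRing.algebraMap_surjective x z
    refine ⟨c • n, ?_⟩
    change (c • n) ⊗ₜ[D] (1 : GermRing x) = _
    rw [TensorProduct.smul_tmul, Algebra.algebraMap_eq_smul_one]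
  | add a b ha hb =>
    obtain ⟨a, rfl⟩ := ha
    obtain ⟨b, rfl⟩ := hb
    exact ⟨a + b, map_add _ _ _⟩

theorem germ_map (f : N →ₗ[D] P) (x : RPoint D) (n : N) :
    germ D x (f n) = f.rTensor (GermRing x) (germ D x n) := rfl

theorem germ_map_congr (f : N →ₗ[D] P) {x : RPoint D} {n n' : N}
    (h : germ D x n = germ D x n') : germ D x (f n) = germ D x (f n') := by
  rw [germ_map, h, germ_map]

theorem smul_germ_eq_zero {x : RPoint D} {d : D} (h : algebraMap D (GermRing x) d = 0)
    (t : N ⊗[D] GermRing x) : d • t = 0 := by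
  obtain ⟨n, rfl⟩ := germ_surjective x t
  obtain ⟨e, he, hed⟩ := GermRing.algebraMap_eq_zero.1 h
  rw [← map_smul, germ_eq_zero_iff]
  exact ⟨e, he, by rw [smul_smul, hed, zero_smul]⟩

theorem smul_germ_congr {x : RPoint D} {d e : D}
    (h : algebraMap D (GermRing x) d = algebraMap D (GermRing x) e)
    (t : N ⊗[D] GermRing x) : d • t = e • t := by
  rw [← sub_eq_zero, ← sub_smul]
  exact smul_germ_eq_zero (by rw [map_sub, h, sub_self]) t

/-- The locus is the union of the nonvanishing sets of the annihilators of `n`. -/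
theorem isOpen_germ_eq_zero (n : N) : IsOpen {x : RPoint D | germ D x n = 0} := by
  have : {x : RPoint D | germ D x n = 0} =
      ⋃ d : {d : D // d • n = 0}, {x : RPoint D | x d.1 ≠ 0} := by
    ext x
    simp only [Set.mem_ofPred_eq, germ_eq_zero_iff, Set.mem_iUnion, Subtype.exists]
    exact ⟨fun ⟨d, h, h'⟩ => ⟨d, h', h⟩, fun ⟨d, h, h'⟩ => ⟨d, h', h⟩⟩
  rw [this]
  exact isOpen_iUnion fun d => RPoint.isOpen_ne_zero d.1

theorem isOpen_germ_eq (n n' : N) : IsOpen {x : RPoint D | germ D x n = germ D x n'} := by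
  simpa only [map_sub, sub_eq_zero] using isOpen_germ_eq_zero (D := D) (n - n')

end Germs

/-! ### Partitions of unity and limits -/

variable (D : Type u) [CInftyRing D]

/-- Partitions of unity exist: for each family of open neighbourhoods `V a` of the points `a`, there
is a locally finite family `η a` of elements of `D` with sum `1`, the germs of `η a` vanishing
outside `V a`. -/
def HasPartitions : Prop :=
  ∀ V : RPoint D → Set (RPoint D), (∀ a, IsOpen (V a)) → (∀ a, a ∈ V a) →
    ∃ η : RPoint D → D,
      (∀ x : RPoint D, ∃ W : Set (RPoint D), IsOpen W ∧ x ∈ W ∧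
        {a | ¬ ∀ y ∈ W, algebraMap D (GermRing y) (η a) = 0}.Finite) ∧
      (∀ (a y : RPoint D), y ∉ V a → algebraMap D (GermRing y) (η a) = 0) ∧
      ∀ y : RPoint D, ∃ T : Finset (RPoint D), (∀ a ∉ T, algebraMap D (GermRing y) (η a) = 0) ∧
        algebraMap D (GermRing y) (∑ a ∈ T, η a) = 1

/-- A module is separated if an element with vanishing germs is zero. -/
def IsSeparatedByGerms (N : Type v) [AddCommGroup N] [Module D N] : Prop :=
  ∀ n : N, (∀ x : RPoint D, germ D x n = 0) → n = 0

/-- Families of germs that are locally given by elements of `N` are given by elements of `N`. -/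
def GermsGlue (N : Type v) [AddCommGroup N] [Module D N] : Prop :=
  ∀ s : ∀ x : RPoint D, N ⊗[D] GermRing x,
    (∀ x, ∃ V : Set (RPoint D), IsOpen V ∧ x ∈ V ∧ ∃ n : N, ∀ y ∈ V, germ D y n = s y) →
    ∃ n : N, ∀ x, germ D x n = s x

variable {D}

section

variable {N : Type v} [AddCommGroup N] [Module D N] {P : Type v} [AddCommGroup P] [Module D P]
  {Q : Type v} [AddCommGroup Q] [Module D Q]

theorem isLimit_zero_iff {n : N} :
    IsLimit D (fun _ : PEmpty.{u + 1} => (0 : N)) n ↔ ∀ x : RPoint D, germ D x n = 0 := by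
  simp [IsLimit]

/-- Both `0` and an element with vanishing germs are limits of the empty sum, whose limit is unique.
-/
theorem IsComplete.isSeparated (h : IsComplete D N) : IsSeparatedByGerms D N := by
  intro n hn
  obtain ⟨l, -, hu⟩ := h PEmpty.{u + 1} (fun _ => 0)
    fun x => ⟨Set.univ, isOpen_univ, trivial, Set.toFinite _⟩
  exact (hu n (isLimit_zero_iff.2 hn)).trans
    (hu 0 (isLimit_zero_iff.2 fun x => map_zero _)).symm

theorem IsSeparatedByGerms.ext (h : IsSeparatedByGerms D N) {n n' : N}
    (hn : ∀ x : RPoint D, germ D x n = germ D x n') : n = n' :=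
  sub_eq_zero.1 (h _ fun x => by rw [map_sub, hn, sub_self])

/-- Near each point only finitely many terms have nonzero germs, and their sum is an element of `N`
representing the limit there; these local limits glue. -/
theorem isComplete_of_glue (hs : IsSeparatedByGerms D N) (hg : GermsGlue D N) :
    IsComplete D N := by
  intro A m hm
  have hl : ∃ l, ∀ x, germ D x l = ∑ᶠ a, germ D x (m a) := by
    refine hg _ fun x => ?_
    obtain ⟨V, hV, hx, hfin⟩ := hm x
    refine ⟨V, hV, hx, ∑ a ∈ hfin.toFinset, m a, fun y hy => ?_⟩
    rw [map_sum, eq_comm]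
    refine finsum_eq_sum_of_support_subset _ fun a ha => ?_
    simp only [Set.Finite.coe_toFinset, Set.mem_ofPred_eq]
    exact fun h => ha (h y hy)
  obtain ⟨l, hl⟩ := hl
  exact ⟨l, hl, fun l' hl' => hs.ext fun x => (hl' x).trans (hl x).symm⟩

/-- Local preimages of a family of germs under `g` can be glued, if the source has limits. -/
theorem HasPartitions.exists_lift (hD : HasPartitions D) (hQ : IsComplete D Q) (g : Q →ₗ[D] P)
    (s : ∀ x : RPoint D, P ⊗[D] GermRing x)
    (hs : ∀ x, ∃ V : Set (RPoint D), IsOpen V ∧ x ∈ V ∧ ∃ w : Q, ∀ y ∈ V, germ D y (g w) = s y) :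
    ∃ w : Q, ∀ x, germ D x (g w) = s x := by
  choose V hV hx w hw using hs
  obtain ⟨η, hfin, hsupp, hsum⟩ := hD V hV hx
  have hkill : ∀ a y, algebraMap D (GermRing y) (η a) = 0 → germ D y (η a • w a) = 0 := by
    intro a y h
    rw [map_smul]
    exact smul_germ_eq_zero h _
  -- The global lift is the limit of `∑ η a • w a`, indexed by the points themselves.
  obtain ⟨l, hl, -⟩ := hQ (RPoint D) (fun a => η a • w a) fun x => by
    obtain ⟨W, hW, hxW, hf⟩ := hfin x
    exact ⟨W, hW, hxW, hf.subset fun a ha h => ha fun y hy => hkill a y (h y hy)⟩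
  refine ⟨l, fun y => ?_⟩
  obtain ⟨T, hT, hT1⟩ := hsum y
  have h1 : germ D y l = ∑ a ∈ T, germ D y (η a • w a) := by
    rw [hl y]
    refine finsum_eq_sum_of_support_subset _ fun a ha => ?_
    by_contra hc
    exact ha (hkill a y (hT a hc))
  -- Valid for every `y`: inside `V a` the element `w a` lifts `s`, and outside both sides vanish
  -- because `η a` has zero germ.
  have h2 : ∀ a, germ D y (g (η a • w a)) = η a • s y := by
    intro a
    rw [map_smul, map_smul]
    by_cases h : y ∈ V a
    · rw [hw a y h]
    · rw [smul_germ_eq_zero (hsupp a y h), smul_germ_eq_zero (hsupp a y h)]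
  rw [germ_map, h1, map_sum]
  simp only [← germ_map, h2]
  rw [← Finset.sum_smul, smul_germ_congr (hT1.trans (map_one _).symm), one_smul]

/-- The converse of `isComplete_of_glue`, as gluing is lifting along the identity. -/
theorem HasPartitions.germsGlue (hD : HasPartitions D) (hN : IsComplete D N) : GermsGlue D N :=
  fun s hs => hD.exists_lift hN LinearMap.id s hs

/-! ### Germwise bijective maps -/

/-- The linear maps inducing bijections on germs. -/
structure GermBijective (f : N →ₗ[D] P) : Prop where
  injective : ∀ (x : RPoint D) (n : N), germ D x (f n) = 0 → germ D x n = 0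
  surjective : ∀ (x : RPoint D) (p : P), ∃ n, germ D x (f n) = germ D x p

theorem GermBijective.congr {f : N →ₗ[D] P} (hf : GermBijective f) {x : RPoint D} {n n' : N}
    (h : germ D x (f n) = germ D x (f n')) : germ D x n = germ D x n' := by
  rw [← sub_eq_zero, ← map_sub]
  exact hf.injective x _ (by rw [map_sub, map_sub, h, sub_self])

/-- Maps to complete modules extend along germwise bijective maps. -/
theorem GermBijective.exists_extension (hD : HasPartitions D) {f : N →ₗ[D] P}
    (hf : GermBijective f) (hQ : IsComplete D Q) (g : N →ₗ[D] Q) :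
    ∃ h : P →ₗ[D] Q, h ∘ₗ f = g := by
  -- The image of `p` is prescribed through its germs. A preimage `n x` of the germ of `p` at `x`
  -- remains one near `x`, and injectivity on germs makes the germ of its image under `g`
  -- independent of choices, so the prescribed germs glue in `Q`.
  have key : ∀ p : P, ∃ q : Q, ∀ (x : RPoint D) (n : N), germ D x (f n) = germ D x p →
      germ D x q = germ D x (g n) := by
    intro p
    choose n hn using fun x => hf.surjective x p
    obtain ⟨q, hq⟩ := hD.germsGlue hQ (fun x => germ D x (g (n x))) fun x =>
      ⟨{y | germ D y (f (n x)) = germ D y p}, isOpen_germ_eq _ _, hn x, g (n x), fun y hy =>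
        germ_map_congr g (hf.congr (hy.trans (hn y).symm))⟩
    exact ⟨q, fun x m hm => (hq x).trans
      (germ_map_congr g (hf.congr ((hn x).trans hm.symm)))⟩
  choose h hh using key
  -- The condition in `key` determines all germs of `h p`, so linearity may be checked on germs.
  refine ⟨⟨⟨h, fun p p' => hQ.isSeparated.ext fun x => ?_⟩, fun c p =>
    hQ.isSeparated.ext fun x => ?_⟩, LinearMap.ext fun n => hQ.isSeparated.ext fun x =>
      hh (f n) x n rfl⟩
  · obtain ⟨n, hn⟩ := hf.surjective x p
    obtain ⟨n', hn'⟩ := hf.surjective x p'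
    rw [hh (p + p') x (n + n') (by simp only [map_add, hn, hn']), map_add, map_add,
      map_add, hh p x n hn, hh p' x n' hn']
  · obtain ⟨n, hn⟩ := hf.surjective x p
    change germ D x (h (c • p)) = germ D x (c • h p)
    rw [hh (c • p) x (c • n) (by simp only [map_smul, hn]), map_smul, map_smul,
      map_smul, hh p x n hn]

theorem GermBijective.hom_ext {f : N →ₗ[D] P} (hf : GermBijective f) (hQ : IsComplete D Q)
    {h h' : P →ₗ[D] Q} (H : h ∘ₗ f = h' ∘ₗ f) : h = h' := by
  refine LinearMap.ext fun p => hQ.isSeparated.ext fun x => ?_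
  obtain ⟨n, hn⟩ := hf.surjective x p
  rw [← germ_map_congr h hn, ← germ_map_congr h' hn]
  exact congrArg (germ D x) (LinearMap.congr_fun H n)

/-- Kernel elements have zero germs. For surjectivity, a preimage of a germ of `p` is a preimage on
a neighbourhood; completeness of `N` glues these, and separation of `P` turns equality of germs into
equality. -/
theorem GermBijective.bijective (hD : HasPartitions D) {f : N →ₗ[D] P} (hf : GermBijective f)
    (hN : IsComplete D N) (hP : IsSeparatedByGerms D P) : Function.Bijective f := by
  constructor
  · refine (injective_iff_map_eq_zero f).2 fun n hn => hN.isSeparated n fun x =>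
      hf.injective x n (by rw [hn, map_zero])
  · intro p
    obtain ⟨n, hn⟩ := hD.exists_lift hN f (fun x => germ D x p) fun x => by
      obtain ⟨n, hn⟩ := hf.surjective x p
      exact ⟨_, isOpen_germ_eq (f n) p, hn, n, fun y hy => hy⟩
    exact ⟨n, hP.ext hn⟩

/-! ### Completeness of finitely presented modules -/

theorem HasPartitions.isComplete_pi (hD : HasPartitions D) {ι : Type v} [Finite ι]
    (hN : IsComplete D N) : IsComplete D (ι → N) := by
  -- Since `ι` is finite, the annihilators of the components can be multiplied together.
  have hext : ∀ (x : RPoint D) (n : ι → N), (∀ i, germ D x (n i) = 0) → germ D x n = 0 := by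
    intro x n h
    cases nonempty_fintype ι
    choose d hd hdn using fun i => germ_eq_zero_iff.1 (h i)
    refine germ_eq_zero_iff.2 ⟨∏ i, d i, Submonoid.prod_mem x.nonvanishing fun i _ => hd i,
      funext fun i => ?_⟩
    obtain ⟨r, hr⟩ := Finset.dvd_prod_of_mem d (Finset.mem_univ i)
    rw [Pi.smul_apply, hr, mul_comm, mul_smul, hdn i, smul_zero]
    rfl
  have hproj : ∀ (x : RPoint D) (n : ι → N) (i : ι),
      germ D x (n i) = (LinearMap.proj (R := D) (φ := fun _ : ι => N) i).rTensor _ (germ D x n) :=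
    fun x n i => germ_map (LinearMap.proj (R := D) (φ := fun _ : ι => N) i) x n
  refine isComplete_of_glue (fun n hn => funext fun i => hN.isSeparated _ fun x => ?_)
    fun s hs => ?_
  · rw [hproj, hn, map_zero]
  · have : ∀ i, ∃ n : N, ∀ x, germ D x n =
        (LinearMap.proj (R := D) (φ := fun _ : ι => N) i).rTensor _ (s x) := fun i =>
      hD.germsGlue hN _ fun x => by
        obtain ⟨V, hV, hx, n, hn⟩ := hs x
        exact ⟨V, hV, hx, n i, fun y hy => by rw [hproj, hn y hy]⟩
    choose n hn using this
    refine ⟨n, fun x => ?_⟩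
    obtain ⟨m, hm⟩ := germ_surjective x (s x)
    rw [← hm, ← sub_eq_zero, ← map_sub]
    refine hext x _ fun i => ?_
    rw [Pi.sub_apply, map_sub, hn i x, hproj, hm, sub_self]

/-- Both conditions come from `exists_lift`. If all germs of `f p` vanish, then `p` is locally in
the image of `g`, and the local preimages glue in `N`; local representatives of a family of germs in
`Q` lift to `P` and glue there. -/
theorem HasPartitions.isComplete_of_exact (hD : HasPartitions D) (hN : IsComplete D N)
    (hP : IsComplete D P) (g : N →ₗ[D] P) (f : P →ₗ[D] Q) (hf : Function.Surjective f)
    (hgf : Function.Exact g f) : IsComplete D Q := by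
  refine isComplete_of_glue (fun q hq => ?_) fun s hs => ?_
  · obtain ⟨p, rfl⟩ := hf q
    obtain ⟨n, hn⟩ := hD.exists_lift hN g (fun x => germ D x p) fun x => by
      obtain ⟨d, hd, hdp⟩ := germ_eq_zero_iff.1 (hq x)
      obtain ⟨n, hn⟩ := (hgf (d • p)).1 (by rw [map_smul, hdp])
      -- From `g n = d • p`, multiplying by a local inverse `e` of `d` makes `e • n` a preimage of
      -- `p` wherever `w` is nonzero.
      obtain ⟨e, w, hw, hwe⟩ := CInftyRing.exists_local_inv x hd
      refine ⟨{y | y w ≠ 0}, RPoint.isOpen_ne_zero w, hw, e • n, fun y hy => ?_⟩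
      rw [map_smul, hn, ← sub_eq_zero, ← map_sub, germ_eq_zero_iff]
      refine ⟨w, hy, ?_⟩
      rw [smul_sub, smul_smul, smul_smul, mul_assoc, mul_comm e d, hwe, sub_self]
    rw [← hP.isSeparated.ext hn]
    exact (hgf _).2 ⟨n, rfl⟩
  · obtain ⟨p, hp⟩ := hD.exists_lift hP f s fun x => by
      obtain ⟨V, hV, hx, q, hq⟩ := hs x
      obtain ⟨p, rfl⟩ := hf q
      exact ⟨V, hV, hx, p, hq⟩
    exact ⟨f p, hp⟩

end

theorem HasPartitions.isComplete_of_finitePresentation (hD : HasPartitions D)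
    (hDD : IsComplete D D) (N : Type u) [AddCommGroup N] [Module D N]
    [Module.FinitePresentation D N] : IsComplete D N := by
  obtain ⟨n, m, f, g, hf, hgf⟩ := Module.FinitePresentation.exists_fin' D N
  -- `isComplete_pi` takes its index type in the universe of the module.
  let e : ∀ k, (ULift.{u} (Fin k) → D) ≃ₗ[D] (Fin k → D) := fun k =>
    LinearEquiv.funCongrLeft D D Equiv.ulift.symm
  refine hD.isComplete_of_exact (hD.isComplete_pi (ι := ULift.{u} (Fin m)) hDD)
    (hD.isComplete_pi (ι := ULift.{u} (Fin n)) hDD)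
    ((e n).symm.toLinearMap ∘ₗ g ∘ₗ (e m).toLinearMap) (f ∘ₗ (e n).toLinearMap)
    (hf.comp (e n).surjective) fun p => ?_
  change f (e n p) = 0 ↔ _
  rw [hgf (e n p)]
  constructor
  · rintro ⟨q, hq⟩
    exact ⟨(e m).symm q, by simp [hq]⟩
  · rintro ⟨q, rfl⟩
    exact ⟨e m q, by simp⟩

/-- Bump functions. -/
theorem HasPartitions.exists_bump (hD : HasPartitions D) [T1Space (RPoint D)] {x : RPoint D}
    {V : Set (RPoint D)} (hV : IsOpen V) (hx : x ∈ V) :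
    ∃ d : D, algebraMap D (GermRing x) d = 1 ∧ ∀ y ∉ V, algebraMap D (GermRing y) d = 0 := by
  classical
  -- All neighbourhoods except the one assigned to `x` avoid `x`, so at `x` the germ of `η x` alone
  -- accounts for the sum `1`.
  obtain ⟨η, -, hsupp, hsum⟩ := hD (fun a => if a = x then V else {x}ᶜ)
    (fun a => by split_ifs <;> [exact hV; exact isOpen_compl_singleton])
    (fun a => by split_ifs with h <;> [exact h ▸ hx; exact h])
  obtain ⟨T, hT, h1⟩ := hsum x
  refine ⟨η x, ?_, fun y hy => hsupp x y (by rwa [if_pos rfl])⟩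
  have h0 : ∀ a, a ≠ x → algebraMap D (GermRing x) (η a) = 0 := fun a ha =>
    hsupp a x (by simp [ha])
  rw [map_sum] at h1
  by_cases hxT : x ∈ T
  · rwa [Finset.sum_eq_single_of_mem x hxT fun a _ ha => h0 a ha] at h1
  · rw [Finset.sum_eq_zero fun a ha => h0 a (ne_of_mem_of_not_mem ha hxT)] at h1
    rw [hT x hxT, h1]

end CInftyModule

/-! ### Partitions of unity from closed embeddings in `ℝⁿ` -/

namespace CInftyRing

variable {D : Type u} [CInftyRing D]

/-- The map `x ↦ (x(e₁), …, x(e_m))`. -/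
def coords {m : ℕ} (e : Fin m → D) (x : RPoint D) : Fin m → ℝ := fun i => x (e i)

theorem continuous_coords {m : ℕ} (e : Fin m → D) : Continuous (coords e) :=
  continuous_pi fun i => RPoint.continuous_eval (e i)

theorem point_op {m : ℕ} (F : SmoothFun m) (e : Fin m → D) (x : RPoint D) :
    x (op F e) = F.1 (coords e x) := x.map_op F e

variable (D) in
/-- Finitely many elements of `D` embed the set of `ℝ`-points as a closed subset of `ℝᵐ`. -/
def IsEmbeddable : Prop :=
  ∃ (m : ℕ) (e : Fin m → D), Topology.IsClosedEmbedding (coords e)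

theorem op_mul_op_eq {m : ℕ} {F G H : SmoothFun m} (h : ∀ p, F.1 p * G.1 p = H.1 p)
    (e : Fin m → D) : op F e * op G e = op H e := by
  rw [op_mul_op]
  exact op_ext (fun p => h p) e

theorem op_add_op_eq {m : ℕ} {F G H : SmoothFun m} (h : ∀ p, F.1 p + G.1 p = H.1 p)
    (e : Fin m → D) : op F e + op G e = op H e := by
  rw [op_add_op]
  exact op_ext (fun p => h p) e

theorem op_sub_op_eq {m : ℕ} {F G H : SmoothFun m} (h : ∀ p, F.1 p - G.1 p = H.1 p)
    (e : Fin m → D) : op F e - op G e = op H e := by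
  rw [sub_eq_iff_eq_add, op_add_op_eq (fun p => ?_) e]
  rw [← h p, sub_add_cancel]

theorem exists_sum_op {m : ℕ} {ι : Type*} (F : ι → SmoothFun m) (e : Fin m → D) (T : Finset ι) :
    ∃ G : SmoothFun m, (∀ p, G.1 p = ∑ i ∈ T, (F i).1 p) ∧ ∑ i ∈ T, op (F i) e = op G e := by
  classical
  induction T using Finset.induction_on with
  | empty => exact ⟨SmoothFun.const m 0, fun p => rfl, zero_op e⟩
  | insert a T ha ih =>
    obtain ⟨G, hG, h⟩ := ih
    refine ⟨SmoothFun.add.comp ![F a, G], fun p => ?_, ?_⟩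
    · rw [Finset.sum_insert ha, ← hG]
      rfl
    · rw [Finset.sum_insert ha, h, op_add_op]

/-- A bump function on `ℝᵐ` centred at the image of `x` and supported where `F` vanishes gives an
annihilator of `op F e` that is nonzero at `x`. -/
theorem germ_op_eq_zero {m : ℕ} (F : SmoothFun m) (e : Fin m → D) (x : RPoint D)
    (h : ∀ᶠ p in nhds (coords e x), F.1 p = 0) : algebraMap D (GermRing x) (op F e) = 0 := by
  obtain ⟨r, hr, hF⟩ := Metric.eventually_nhds_iff_ball.1 h
  let b : ContDiffBump (coords e x) := ⟨r / 2, r, half_pos hr, half_lt_self hr⟩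
  let B : SmoothFun m := ⟨b, b.contDiff⟩
  refine GermRing.algebraMap_eq_zero.2 ⟨op B e, ?_, ?_⟩
  · rw [point_op]
    change b _ ≠ 0
    rw [b.one_of_mem_closedBall (Metric.mem_closedBall_self b.rIn_pos.le)]
    exact one_ne_zero
  · rw [zero_op e]
    refine op_mul_op_eq (fun p => ?_) e
    change b p * F.1 p = 0
    by_cases hp : p ∈ Metric.ball (coords e x) r
    · rw [hF p hp, mul_zero]
    · rw [b.zero_of_le_dist (not_lt.1 hp), zero_mul]

theorem germ_op_congr {m : ℕ} (F G : SmoothFun m) (e : Fin m → D) (x : RPoint D)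
    (h : ∀ᶠ p in nhds (coords e x), F.1 p = G.1 p) :
    algebraMap D (GermRing x) (op F e) = algebraMap D (GermRing x) (op G e) := by
  let H : SmoothFun m := ⟨fun p => F.1 p - G.1 p, F.2.sub G.2⟩
  rw [← sub_eq_zero, ← map_sub, op_sub_op_eq (H := H) (fun p => rfl) e]
  exact germ_op_eq_zero H e x (h.mono fun p hp => sub_eq_zero.2 hp)

theorem IsEmbeddable.t1Space (h : IsEmbeddable D) : T1Space (RPoint D) := by
  obtain ⟨m, e, he⟩ := h
  exact he.isEmbedding.t1Space

open scoped Manifold in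
-- A smooth partition of unity on `ℝᵐ` is pulled back. The index `none` stands for the complement of
-- the image, open because the embedding is closed; it completes the cover and contributes only zero
-- germs.
theorem IsEmbeddable.hasPartitions (h : IsEmbeddable D) : CInftyModule.HasPartitions D := by
  classical
  obtain ⟨m, e, he⟩ := h
  intro V hV hmem
  choose V' hV' hVV' using fun a => he.isInducing.isOpen_iff.1 (hV a)
  have hin : ∀ a x, coords e x ∈ V' a ↔ x ∈ V a := fun a x => by rw [← hVV' a]; rfl
  let U : Option (RPoint D) → Set (Fin m → ℝ) := fun i => i.elim (Set.range (coords e))ᶜ V'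
  obtain ⟨f, hf⟩ := SmoothPartitionOfUnity.exists_isSubordinate 𝓘(ℝ, Fin m → ℝ)
    (isClosed_univ (X := Fin m → ℝ)) U
    (by rintro (_ | a) <;> [exact he.isClosed_range.isOpen_compl; exact hV' a])
    (by
      intro p _
      by_cases hp : p ∈ Set.range (coords e)
      · obtain ⟨x, rfl⟩ := hp
        exact Set.mem_iUnion.2 ⟨some x, (hin x x).2 (hmem x)⟩
      · exact Set.mem_iUnion.2 ⟨none, hp⟩)
  let F : Option (RPoint D) → SmoothFun m := fun i => ⟨f i, (f i).contMDiff.contDiff⟩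
  have hoff : ∀ i x, coords e x ∉ U i → algebraMap D (GermRing x) (op (F i) e) = 0 :=
    fun i x hx => germ_op_eq_zero _ _ _ (notMem_tsupport_iff_eventuallyEq.1 fun h => hx (hf i h))
  have hloc : ∀ x : RPoint D, ∃ N ∈ nhds (coords e x), ∃ T : Finset (Option (RPoint D)),
      ∀ i ∉ T, ∀ p ∈ N, f i p = 0 := by
    intro x
    obtain ⟨N, hN, hfin⟩ := f.locallyFinite (coords e x)
    refine ⟨N, hN, hfin.toFinset, fun i hi p hp => ?_⟩
    by_contra hc
    exact hi ((Set.Finite.mem_toFinset _).2 ⟨p, hc, hp⟩)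
  have hvan : ∀ (N : Set (Fin m → ℝ)) (i), (∀ p ∈ N, f i p = 0) →
      ∀ x : RPoint D, N ∈ nhds (coords e x) → algebraMap D (GermRing x) (op (F i) e) = 0 :=
    fun N i hi x hN => germ_op_eq_zero _ _ _ (Filter.mem_of_superset hN hi)
  refine ⟨fun a => op (F (some a)) e, fun x => ?_, fun a y hy => ?_, fun y => ?_⟩
  · obtain ⟨N, hN, T, hT⟩ := hloc x
    refine ⟨coords e ⁻¹' interior N, isOpen_interior.preimage (continuous_coords e),
      mem_interior_iff_mem_nhds.2 hN, (T.preimage some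
        (Option.some_injective _).injOn).finite_toSet.subset fun a ha => ?_⟩
    rw [Finset.mem_coe, Finset.mem_preimage]
    by_contra hc
    exact ha fun y hy => hvan N _ (hT _ hc) y (mem_interior_iff_mem_nhds.1 hy)
  · exact hoff _ y fun h => hy ((hin a y).1 h)
  · obtain ⟨N, hN, T, hT⟩ := hloc y
    refine ⟨T.preimage some (Option.some_injective _).injOn, fun a ha => ?_, ?_⟩
    · rw [Finset.mem_preimage] at ha
      exact hvan N _ (hT _ ha) y hN
    -- The sum is first computed with a possible term `none`, then that term is dropped, its germ
    -- being zero.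
    · have h1 : algebraMap D (GermRing y) (∑ i ∈ T, op (F i) e) = 1 := by
        obtain ⟨G, hG, h⟩ := exists_sum_op F e T
        rw [h, ← map_one (algebraMap D (GermRing y)), one_op e]
        refine germ_op_congr _ _ _ _ (Filter.mem_of_superset hN fun p hp => ?_)
        change G.1 p = 1
        rw [hG, ← f.sum_eq_one (Set.mem_univ p)]
        refine (finsum_eq_sum_of_support_subset _ fun i hi => ?_).symm
        by_contra hc
        exact hi (hT i hc p hp)
      rw [map_sum] at h1 ⊢
      rw [← h1]
      refine Finset.sum_preimage _ _ _
        (fun i => algebraMap D (GermRing y) (op (F i) e)) fun i _ hi => ?_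
      cases i with
      | none => exact hoff none y fun h => h ⟨y, rfl⟩
      | some a => exact absurd ⟨a, rfl⟩ hi

/-- The coordinates are the generators. Every element is a smooth function of them, so they
determine points and topology; the image is the common zero set of the relations among them, hence
closed. -/
theorem IsFinitelyGenerated.isEmbeddable (h : IsFinitelyGenerated D) : IsEmbeddable D := by
  obtain ⟨m, e, he⟩ := h
  refine ⟨m, e, ⟨⟨⟨?_⟩, ?_⟩, ?_⟩⟩
  · refine le_antisymm (continuous_iff_le_induced.1 (continuous_coords e)) (le_iInf fun c => ?_)
    obtain ⟨F, rfl⟩ := he c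
    rw [← continuous_iff_le_induced]
    let := TopologicalSpace.induced (coords e) inferInstance
    simp only [point_op]
    exact F.2.continuous.comp continuous_induced_dom
  · intro x y hxy
    ext c
    obtain ⟨F, rfl⟩ := he c
    rw [point_op, point_op, hxy]
  · have : Set.range (coords e) = ⋂ (F : SmoothFun m) (_ : op F e = 0), {p | F.1 p = 0} := by
      ext p
      simp only [Set.mem_iInter, Set.mem_ofPred_eq]
      constructor
      · rintro ⟨x, rfl⟩ F hF
        rw [← point_op, hF]
        exact x.map_op (SmoothFun.const 0 0) ![]
      · intro hp
        choose F hF using he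
        -- As `p` satisfies all relations, evaluation at `p` does not depend on how an element is
        -- written in the generators, and so defines a point.
        have hwd : ∀ {G H : SmoothFun m}, op G e = op H e → G.1 p = H.1 p := by
          intro G H hGH
          let K : SmoothFun m := ⟨fun p => G.1 p - H.1 p, G.2.sub H.2⟩
          refine sub_eq_zero.1 (hp K ?_)
          rw [← op_sub_op_eq (H := K) (fun p => rfl) e, hGH, sub_self]
        refine ⟨⟨fun c => (F c).1 p, fun {n} f c => ?_⟩, funext fun i => ?_⟩
        · refine hwd (G := F (op f c)) (H := f.comp fun i => F (c i)) ?_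
          rw [← hF, op_comp]
          congr 1
          funext i
          exact hF (c i)
        · refine hwd (G := F (e i)) (H := SmoothFun.proj i) ?_
          rw [← hF, op_proj]
    rw [this]
    exact isClosed_iInter fun F => isClosed_iInter fun _ =>
      isClosed_eq F.2.continuous continuous_const

/-- Open sets of `ℝ`-points are the nonvanishing sets of elements. -/
theorem IsEmbeddable.exists_nonvanishing_eq (h : IsEmbeddable D) {U : Set (RPoint D)}
    (hU : IsOpen U) : ∃ d : D, U = {x : RPoint D | x d ≠ 0} := by
  obtain ⟨m, e, he⟩ := h
  obtain ⟨U', hU', rfl⟩ := he.isInducing.isOpen_iff.1 hU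
  obtain ⟨f, hf, hfc, -⟩ := hU'.exists_contDiff_support_eq (n := ⊤)
  let F : SmoothFun m := ⟨f, hfc⟩
  refine ⟨op F e, ?_⟩
  ext x
  rw [Set.mem_preimage, ← hf, Set.mem_ofPred_eq, point_op]
  rfl

end CInftyRing

/-! ### The points of `O_X(U)` -/

/-- The point of `C` underlying a point of `D`, for a morphism `C → D`. -/
def RPoint.comap {C : Type u} {D : Type v} [CInftyRing C] [CInftyRing D] (φ : CInftyHom C D)
    (y : RPoint D) : RPoint C where
  toFun c := y (φ.toFun c)
  map_op f c := by rw [φ.map_op, y.map_op]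

theorem RPoint.continuous_of_eval {C : Type u} [CInftyRing C] {Z : Type*} [TopologicalSpace Z]
    {g : Z → RPoint C} (h : ∀ c : C, Continuous fun z => g z c) : Continuous g :=
  continuous_iInf_rng.2 fun c => continuous_induced_rng.2 (h c)

/-- The value at `x` of a germ at `x`. -/
def GermRing.point {C : Type u} [CInftyRing C] (x : RPoint C) : RPoint (GermRing x) where
  toFun := Quotient.lift x.toFun fun a b ⟨d, hd, h⟩ => by
    have := congrArg x.toFun h
    rw [x.map_mul, x.map_mul] at this
    exact mul_left_cancel₀ hd this
  map_op f s := by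
    obtain ⟨c, rfl⟩ := GermRing.exists_lift x s
    change Quotient.lift _ _ (GermRing.opAux x f _) = _
    rw [GermRing.opAux_mk]
    exact x.map_op f c

theorem GermRing.point_algebraMap {C : Type u} [CInftyRing C] (x : RPoint C) (c : C) :
    GermRing.point x (algebraMap C (GermRing x) c) = x c := rfl

theorem GermRing.isUnit_of_ne_zero {C : Type u} [CInftyRing C] {x : RPoint C} {z : GermRing x}
    (h : GermRing.point x z ≠ 0) : IsUnit z := by
  obtain ⟨c, rfl⟩ := GermRing.algebraMap_surjective x z
  exact GermRing.isUnit_algebraMap x h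

namespace CSpec

variable {C : Type u} [CInftyRing C]

/-- The germ at `x ∈ U` of a section over `U`. -/
noncomputable def stalkHom {U : Opens (space C)} (x : U) : CInftyHom (Sec U) (GermRing x.1) where
  toFun s := s.1 x
  map_op _ _ := rfl

/-- Evaluation of sections at `x ∈ U`. -/
noncomputable def secPoint {U : Opens (space C)} (x : U) : RPoint (Sec U) :=
  (GermRing.point x.1).comap (stalkHom x)

section

variable {U : Opens (space C)}

theorem Sec.ext {s t : Sec U} (h : ∀ x, s.1 x = t.1 x) : s = t := Subtype.ext (funext h)

theorem Sec.mul_val (s t : Sec U) (x : U) : (s * t).1 x = s.1 x * t.1 x :=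
  _root_.map_mul (stalkHom x).toRingHom s t

theorem Sec.one_val (x : U) : (1 : Sec U).1 x = 1 := _root_.map_one (stalkHom x).toRingHom

theorem Sec.zero_val (x : U) : (0 : Sec U).1 x = 0 := _root_.map_zero (stalkHom x).toRingHom

theorem toSec_val (c : C) (x : U) : ((toSec U).toFun c).1 x = algebraMap C (GermRing x.1) c := rfl

theorem toSec_mul (a b : C) : (toSec U).toFun (a * b) = (toSec U).toFun a * (toSec U).toFun b :=
  map_mul (toSec U).toRingHom a b

theorem secPoint_apply (x : U) (s : Sec U) : secPoint x s = GermRing.point x.1 (s.1 x) := rfl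

theorem secPoint_toSec (x : U) (c : C) : secPoint x ((toSec U).toFun c) = x.1 c := rfl

theorem continuous_secPoint : Continuous (secPoint : U → RPoint (Sec U)) := by
  refine RPoint.continuous_of_eval fun s => continuous_iff_continuousAt.2 fun x => ?_
  obtain ⟨V, hx, hVU, c, hc⟩ := Sec.exists_local s x
  have hev : (fun y : U => y.1 c) =ᶠ[nhds x] fun y => secPoint y s := by
    filter_upwards [(V.isOpen.preimage continuous_subtype_val).mem_nhds hx] with y hy
    rw [secPoint_apply, hc ⟨y.1, hy⟩]
    rfl
  refine ContinuousAt.congr ?_ hev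
  exact ((RPoint.continuous_eval c).comp continuous_subtype_val).continuousAt

theorem Sec.isUnit {s : Sec U} (h : ∀ x : U, secPoint x s ≠ 0) : IsUnit s := by
  have hu : ∀ x : U, IsUnit (s.1 x) := fun x => GermRing.isUnit_of_ne_zero (h x)
  -- The pointwise inverse is a section: where `s` is given by `c`, its inverse is given near `x` by
  -- a local inverse `e` of `c`.
  let t : Sec U := ⟨fun x => Ring.inverse (s.1 x), pred_of_local _ fun x => by
    obtain ⟨V, hx, hVU, c, hc⟩ := Sec.exists_local s x
    have hcx : x.1 c ≠ 0 := by
      have := h x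
      rwa [secPoint_apply, hc ⟨x.1, hx⟩, GermRing.point_algebraMap] at this
    obtain ⟨e, w, hw, hwe⟩ := CInftyRing.exists_local_inv x.1 hcx
    let W : Opens (space C) := ⟨{y : RPoint C | y w ≠ 0}, RPoint.isOpen_ne_zero w⟩
    refine ⟨V ⊓ W, ⟨hx, hw⟩, inf_le_left.trans hVU, e, fun y => ?_⟩
    have h1 : s.1 ⟨y.1, hVU y.2.1⟩ * algebraMap C (GermRing y.1) e = 1 := by
      rw [hc ⟨y.1, y.2.1⟩, ← map_mul, ← map_one (algebraMap C (GermRing y.1)),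
        GermRing.algebraMap_eq]
      exact ⟨w, y.2.2, by rw [hwe, mul_one]⟩
    change Ring.inverse (s.1 _) = _
    rw [← mul_one (Ring.inverse _), ← h1, Ring.inverse_mul_cancel_left _ _ (hu _)]⟩
  refine IsUnit.of_mul_eq_one t (Sec.ext fun x => ?_)
  rw [Sec.mul_val, Sec.one_val]
  exact Ring.mul_inverse_cancel _ (hu x)

/-- A section not vanishing at `x` is invertible near `x`. -/
theorem Sec.exists_isUnit_res (s : Sec U) (x : U) (h : secPoint x s ≠ 0) :
    ∃ (V : Opens (space C)) (_ : x.1 ∈ V) (i : V ≤ U), IsUnit ((res (homOfLE i)).toFun s) := by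
  obtain ⟨V, hx, hVU, c, hc⟩ := Sec.exists_local s x
  let W : Opens (space C) := ⟨{y : RPoint C | y c ≠ 0}, RPoint.isOpen_ne_zero c⟩
  have hval : ∀ y : V, secPoint (⟨y.1, hVU y.2⟩ : U) s = y.1 c := fun y => by
    rw [secPoint_apply, hc y, GermRing.point_algebraMap]
  refine ⟨V ⊓ W, ⟨hx, ?_⟩, inf_le_left.trans hVU, Sec.isUnit fun y => ?_⟩
  · rw [hval ⟨x.1, hx⟩] at h
    exact h
  · change secPoint (⟨y.1, hVU y.2.1⟩ : U) s ≠ 0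
    rw [hval ⟨y.1, y.2.1⟩]
    exact y.2.2

/-- Over `U`, multiplication by a bump function replaces a section by an element of `C`. -/
theorem toSec_mul_eq_toSec_mul {s : Sec U} {c b : C} {V : Set (RPoint C)}
    (hc : ∀ y : U, y.1 ∈ V → s.1 y = algebraMap C (GermRing y.1) c)
    (hb : ∀ y ∉ V, algebraMap C (GermRing y) b = 0) :
    (toSec U).toFun b * s = (toSec U).toFun b * (toSec U).toFun c := by
  refine Sec.ext fun y => ?_
  rw [Sec.mul_val, Sec.mul_val, toSec_val, toSec_val]
  by_cases hy : y.1 ∈ V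
  · rw [hc y hy]
  · rw [hb _ hy, zero_mul, zero_mul]

end

/-- If `U` is the nonvanishing set of `d`, then `d` is a unit in `O_X(U)`, so no point of `O_X(U)`
can send it to zero. -/
theorem comap_toSec_mem (hC : CInftyRing.IsEmbeddable C) {U : Opens (space C)}
    (y : RPoint (Sec U)) : y.comap (toSec U) ∈ U := by
  obtain ⟨d, hd⟩ := hC.exists_nonvanishing_eq U.isOpen
  have hu : IsUnit ((toSec U).toFun d) := Sec.isUnit fun x => by
    have : x.1 ∈ (U : Set (RPoint C)) := x.2
    rw [hd] at this
    exact this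
  change _ ∈ (U : Set (RPoint C))
  rw [hd]
  obtain ⟨t, ht⟩ := hu.exists_right_inv
  have := y.map_mul ((toSec U).toFun d) t
  rw [ht, y.map_one] at this
  exact left_ne_zero_of_mul (this ▸ one_ne_zero)

/-- With a bump `b` around the underlying point, `b * s = b * c` for some `c` in `C`. As `y` sends
`b` to `1`, its value on `s` is its value on `c`. -/
theorem secPoint_comap (hC : CInftyRing.IsEmbeddable C) {U : Opens (space C)}
    (y : RPoint (Sec U)) : secPoint ⟨y.comap (toSec U), comap_toSec_mem hC y⟩ = y := by
  ext s
  have := hC.t1Space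
  obtain ⟨V, hx, hVU, c, hc⟩ := Sec.exists_local s ⟨y.comap (toSec U), comap_toSec_mem hC y⟩
  obtain ⟨b, hb1, hb⟩ := hC.hasPartitions.exists_bump V.isOpen hx
  have key := toSec_mul_eq_toSec_mul (fun z hz => hc ⟨z.1, hz⟩) hb
  have h1 : y ((toSec U).toFun b) = 1 := by
    have := congrArg (GermRing.point (y.comap (toSec U))) hb1
    rw [RPoint.map_one] at this
    exact this
  have h2 := congrArg y key
  rw [y.map_mul, y.map_mul, h1, one_mul, one_mul] at h2
  rw [secPoint_apply, hc ⟨_, hx⟩, h2]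
  rfl

/-- The points of `O_X(U)` are the points of `U`. -/
noncomputable def secHomeo (hC : CInftyRing.IsEmbeddable C) (U : Opens (space C)) :
    RPoint (Sec U) ≃ₜ U where
  toFun y := ⟨y.comap (toSec U), comap_toSec_mem hC y⟩
  invFun := secPoint
  left_inv := secPoint_comap hC
  right_inv _ := rfl
  continuous_toFun := Continuous.subtype_mk
    (RPoint.continuous_of_eval fun c => RPoint.continuous_eval ((toSec U).toFun c)) _
  continuous_invFun := continuous_secPoint

/-- An open subset becomes closed after adding a coordinate: if `U` is where `f ≠ 0`, then `x ↦ (1 /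
f x, x)` embeds it onto the closed set cut out by `f * t = 1` over the image of `X`. -/
theorem isEmbeddable_sec (hC : CInftyRing.IsEmbeddable C) (U : Opens (space C)) :
    CInftyRing.IsEmbeddable (Sec U) := by
  obtain ⟨m, e, he⟩ := id hC
  obtain ⟨U', hU', hUU'⟩ := he.isInducing.isOpen_iff.1 U.isOpen
  obtain ⟨f, hf, hfc, -⟩ := hU'.exists_contDiff_support_eq (n := ⊤)
  let F : SmoothFun m := ⟨f, hfc⟩
  have hmem : ∀ x : RPoint C, x ∈ U ↔ f (CInftyRing.coords e x) ≠ 0 := by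
    intro x
    change x ∈ (U : Set (RPoint C)) ↔ _
    rw [← hUU', Set.mem_preimage, ← hf]
    rfl
  have hFx : ∀ x : RPoint C, x (CInftyRing.op F e) = f (CInftyRing.coords e x) :=
    CInftyRing.point_op F e
  have hu : IsUnit ((toSec U).toFun (CInftyRing.op F e)) := Sec.isUnit fun x => by
    rw [secPoint_toSec, hFx]
    exact (hmem _).1 x.2
  obtain ⟨t, ht⟩ := hu.exists_right_inv
  let E : Fin (m + 1) → Sec U := Fin.cons t fun i => (toSec U).toFun (e i)
  have htail : ∀ y : RPoint (Sec U), Fin.tail (CInftyRing.coords E y) =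
      CInftyRing.coords e (secHomeo hC U y).1 := fun y => rfl
  have hcont : Continuous (Fin.tail : (Fin (m + 1) → ℝ) → Fin m → ℝ) :=
    continuous_pi fun i => continuous_apply i.succ
  have hemb : Topology.IsEmbedding fun y => CInftyRing.coords e (secHomeo hC U y).1 :=
    he.isEmbedding.comp (Topology.IsEmbedding.subtypeVal.comp (secHomeo hC U).isEmbedding)
  refine ⟨m + 1, E, ⟨⟨?_, fun y y' h => hemb.injective (congrArg Fin.tail h)⟩, ?_⟩⟩
  · exact Topology.IsInducing.of_comp (CInftyRing.continuous_coords E) hcont hemb.isInducing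
  · have hinv : ∀ y : RPoint (Sec U),
        f (CInftyRing.coords e (secHomeo hC U y).1) * y t = 1 := by
      intro y
      have := y.map_mul ((toSec U).toFun (CInftyRing.op F e)) t
      rw [ht, y.map_one] at this
      rw [this, ← hFx]
      rfl
    have hrange : Set.range (CInftyRing.coords E) =
        Fin.tail ⁻¹' Set.range (CInftyRing.coords e) ∩ {v | f (Fin.tail v) * v 0 = 1} := by
      ext v
      constructor
      · rintro ⟨y, rfl⟩
        exact ⟨⟨_, (htail y).symm⟩, hinv y⟩
      · rintro ⟨⟨x, hx⟩, hv⟩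
        rw [Set.mem_ofPred_eq, ← hx] at hv
        have hxU : x ∈ U := (hmem x).2 (left_ne_zero_of_mul (hv ▸ one_ne_zero))
        refine ⟨secPoint ⟨x, hxU⟩, ?_⟩
        rw [← Fin.cons_self_tail v, ← Fin.cons_self_tail (CInftyRing.coords E _), ← hx, htail]
        congr 1
        exact mul_left_cancel₀ ((hmem x).1 hxU) ((hinv (secPoint ⟨x, hxU⟩)).trans hv.symm)
    rw [hrange]
    exact (he.isClosed_range.preimage hcont).inter
      (isClosed_eq ((hfc.continuous.comp hcont).mul (continuous_apply 0)) continuous_const)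

/-- A morphism `D → O_X(U)` identifying the points of `D` with the points of `U`. -/
structure Chart (D : Type u) [CInftyRing D] (U : Opens (space C)) where
  hom : CInftyHom D (Sec U)
  homeo : RPoint D ≃ₜ U
  eval_eq : ∀ (y : RPoint D) (d : D), y d = secPoint (homeo y) (hom.toFun d)

variable (C) in
/-- The morphism `C → O_X(X)` as a chart. -/
noncomputable def Chart.global : Chart C (⊤ : Opens (space C)) where
  hom := toSec ⊤
  homeo := (Homeomorph.Set.univ (RPoint C)).symm
  eval_eq _ _ := rfl

/-- The identity of `O_X(U)` as a chart. -/
noncomputable def Chart.sections (hC : CInftyRing.IsEmbeddable C) (U : Opens (space C)) :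
    Chart (Sec U) U where
  hom := ⟨id, fun _ _ => rfl⟩
  homeo := secHomeo hC U
  eval_eq y s := congrArg (fun z : RPoint (Sec U) => z s) (secPoint_comap hC y).symm

/-! ### Sections of `O_X`-modules -/

/-- The sections over `U` of an `O_X`-module. -/
noncomputable abbrev OMod.sec (E : OMod C) (U : Opens (space C)) : ModuleCat.{u} (Sec U) :=
  (sectionsFunctor U).obj E

/-- The restriction maps of an `O_X`-module. -/
noncomputable def OMod.restr (E : OMod C) {U V : Opens (space C)} (h : V ≤ U) :
    E.sec U →+ E.sec V where
  toFun e := E.val.map (homOfLE h).op e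
  map_zero' := map_zero (E.val.map (homOfLE h).op).hom
  map_add' := map_add (E.val.map (homOfLE h).op).hom

namespace OMod

variable (E : OMod C) {U V W : Opens (space C)}

theorem restr_smul (h : V ≤ U) (s : Sec U) (e : E.sec U) :
    E.restr h (s • e) = (res (homOfLE h)).toFun s • E.restr h e :=
  E.val.map_smul (homOfLE h).op s e

theorem restr_restr (h : V ≤ U) (h' : W ≤ V) (e : E.sec U) :
    E.restr h' (E.restr h e) = E.restr (h'.trans h) e :=
  (E.val.map_comp_apply (homOfLE h).op (homOfLE h').op e).symm

/-- The underlying sheaf of abelian groups. -/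
noncomputable def abSheaf : TopCat.Sheaf AddCommGrpCat.{u} (space C) :=
  (SheafOfModules.toSheaf (structureSheaf C)).obj E

theorem eq_of_locally_eq {e e' : E.sec U}
    (h : ∀ x ∈ U, ∃ (V : Opens (space C)) (i : V ≤ U), x ∈ V ∧ E.restr i e = E.restr i e') :
    e = e' := by
  choose V i hx hV using h
  exact TopCat.Sheaf.eq_of_locally_eq' E.abSheaf (fun x : U => V x.1 x.2) U
    (fun x => homOfLE (i x.1 x.2))
    (fun x hxU => Opens.mem_iSup.2 ⟨⟨x, hxU⟩, hx x hxU⟩) e e' fun x => hV x.1 x.2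

theorem exists_glue {ι : Type u} (V : ι → Opens (space C)) (i : ∀ a, V a ≤ U)
    (hcov : ∀ x ∈ U, ∃ a, x ∈ V a) (e : ∀ a, E.sec (V a))
    (h : ∀ a b, E.restr (inf_le_left : V a ⊓ V b ≤ V a) (e a) =
      E.restr (inf_le_right : V a ⊓ V b ≤ V b) (e b)) :
    ∃ e' : E.sec U, ∀ a, E.restr (i a) e' = e a := by
  obtain ⟨e', he', -⟩ := TopCat.Sheaf.existsUnique_gluing' E.abSheaf V U (fun a => homOfLE (i a))
    (fun x hx => Opens.mem_iSup.2 (hcov x hx)) e (fun a b => h a b)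
  exact ⟨e', he'⟩

end OMod

/-! ### Germs of sections and completeness -/

namespace OMod

open CInftyModule

variable (E : OMod C) {U : Opens (space C)}

theorem restr_eq_zero_of_isUnit {V : Opens (space C)} (i : V ≤ U) {s : Sec U} {e : E.sec U}
    (hs : IsUnit ((res (homOfLE i)).toFun s)) (h : E.restr i (s • e) = 0) : E.restr i e = 0 := by
  rw [restr_smul] at h
  exact (hs.smul_eq_zero).1 h

/-- A section killed by a function not vanishing at `x` is zero near `x`. -/
theorem exists_restr_eq_zero {s : Sec U} {e : E.sec U} (h : s • e = 0) (x : U)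
    (hs : secPoint x s ≠ 0) :
    ∃ (V : Opens (space C)) (i : V ≤ U), x.1 ∈ V ∧ E.restr i e = 0 := by
  obtain ⟨V, hx, i, hu⟩ := Sec.exists_isUnit_res s x hs
  exact ⟨V, i, hx, E.restr_eq_zero_of_isUnit i hu (by rw [h, map_zero])⟩

variable {D : Type u} [CInftyRing D] (κ : Chart D U) [Module D (E.sec U)]

/-- The bridge between algebra and sheaves. A function not vanishing at a point is invertible
nearby, so what it kills is zero there; conversely, a section zero on `V` is killed by a bump
function supported in `V`. The chart covers both `C` acting on global sections and `O_X(U)` acting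
on sections over `U`. -/
theorem germ_eq_zero_iff_restr (hD : CInftyRing.IsEmbeddable D)
    (hκ : ∀ (d : D) (e : E.sec U), d • e = κ.hom.toFun d • e) (y : RPoint D) (e : E.sec U) :
    germ D y e = 0 ↔
      ∃ (V : Opens (space C)) (i : V ≤ U), (κ.homeo y).1 ∈ V ∧ E.restr i e = 0 := by
  rw [germ_eq_zero_iff]
  constructor
  · rintro ⟨d, hd, hde⟩
    rw [hκ] at hde
    exact E.exists_restr_eq_zero hde _ (by rwa [← κ.eval_eq])
  · rintro ⟨V, i, hV, hVe⟩
    have := hD.t1Space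
    obtain ⟨b, hb1, hb⟩ := hD.hasPartitions.exists_bump (x := y)
      (V := {z | (κ.homeo z).1 ∈ V})
      (V.isOpen.preimage (continuous_subtype_val.comp κ.homeo.continuous)) hV
    refine ⟨b, ?_, ?_⟩
    · have := congrArg (GermRing.point y) hb1
      rw [RPoint.map_one, GermRing.point_algebraMap] at this
      rw [this]
      exact one_ne_zero
    · refine E.eq_of_locally_eq fun x hx => ?_
      rw [hκ]
      by_cases hxV : x ∈ V
      · exact ⟨V, i, hxV, by rw [restr_smul, hVe, smul_zero, map_zero]⟩
      -- Outside `V` the germ of `b` is zero, so some `d` nonzero at the point kills `b`, and `b •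
      -- e` vanishes near it.
      · have hb0 := hb (κ.homeo.symm ⟨x, hx⟩) (by simpa using hxV)
        obtain ⟨d, hd, hdb⟩ := GermRing.algebraMap_eq_zero.1 hb0
        have h0 : κ.hom.toFun d • κ.hom.toFun b • e = 0 := by
          rw [← hκ, ← hκ, smul_smul, hdb, zero_smul]
        obtain ⟨W, j, hxW, hW⟩ := E.exists_restr_eq_zero h0 ⟨x, hx⟩ (by
          rwa [κ.eval_eq, Homeomorph.apply_symm_apply] at hd)
        exact ⟨W, j, hxW, by rw [hW, map_zero]⟩

theorem isSeparatedByGerms_sec (hD : CInftyRing.IsEmbeddable D)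
    (hκ : ∀ (d : D) (e : E.sec U), d • e = κ.hom.toFun d • e) :
    IsSeparatedByGerms D (E.sec U) := by
  intro e he
  refine E.eq_of_locally_eq fun x hx => ?_
  obtain ⟨V, i, hV, h⟩ := (E.germ_eq_zero_iff_restr κ hD hκ _ _).1 (he (κ.homeo.symm ⟨x, hx⟩))
  rw [Homeomorph.apply_symm_apply] at hV
  exact ⟨V, i, hV, by rw [h, map_zero]⟩

theorem germsGlue_sec (hD : CInftyRing.IsEmbeddable D)
    (hκ : ∀ (d : D) (e : E.sec U), d • e = κ.hom.toFun d • e) : GermsGlue D (E.sec U) := by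
  intro s hs
  choose V hV hx e he using hs
  -- The neighbourhoods are carried over to `X`. On overlaps the local sections have equal germs,
  -- hence agree locally, and the sheaf axiom applies.
  let V' : RPoint D → Opens (space C) := fun y => ⟨Subtype.val '' (κ.homeo '' V y),
    U.isOpen.isOpenMap_subtype_val _ (κ.homeo.isOpenMap _ (hV y))⟩
  have hV'U : ∀ y, V' y ≤ U := by
    rintro y _ ⟨x, -, rfl⟩
    exact x.2
  have hV' : ∀ (y : RPoint D) (x : U), x.1 ∈ V' y → κ.homeo.symm x ∈ V y := by
    rintro y x ⟨_, ⟨z, hz, rfl⟩, h⟩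
    rwa [← Subtype.ext h, Homeomorph.symm_apply_apply]
  have hcompat : ∀ a b, E.restr (inf_le_left.trans (hV'U a) : V' a ⊓ V' b ≤ U) (e a) =
      E.restr (inf_le_left.trans (hV'U a)) (e b) := by
    intro a b
    refine E.eq_of_locally_eq fun x hx => ?_
    have hxU : x ∈ U := hV'U a hx.1
    have hab : germ D (κ.homeo.symm ⟨x, hxU⟩) (e a - e b) = 0 := by
      rw [map_sub, he a _ (hV' a ⟨x, hxU⟩ hx.1), he b _ (hV' b ⟨x, hxU⟩ hx.2), sub_self]
    obtain ⟨W, i, hW, h⟩ := (E.germ_eq_zero_iff_restr κ hD hκ _ _).1 hab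
    rw [Homeomorph.apply_symm_apply] at hW
    refine ⟨V' a ⊓ V' b ⊓ W, inf_le_left, ⟨hx, hW⟩, ?_⟩
    rw [restr_restr, restr_restr, ← sub_eq_zero, ← map_sub,
      ← E.restr_restr i inf_le_right (e a - e b), h, map_zero]
  obtain ⟨l, hl⟩ := E.exists_glue V' hV'U
    (fun x hxU => ⟨κ.homeo.symm ⟨x, hxU⟩, _, ⟨_, hx _, rfl⟩, by simp⟩)
    (fun a => E.restr (hV'U a) (e a)) fun a b => by
      rw [restr_restr, restr_restr]
      exact hcompat a b
  refine ⟨l, fun y => ?_⟩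
  rw [← he y y (hx y), ← sub_eq_zero, ← map_sub, E.germ_eq_zero_iff_restr κ hD hκ]
  exact ⟨V' y, hV'U y, ⟨_, ⟨y, hx y, rfl⟩, rfl⟩, by rw [map_sub, hl, sub_self]⟩

/-- The sections of an `O_X`-module form a complete module. -/
theorem isComplete_sec (hD : CInftyRing.IsEmbeddable D)
    (hκ : ∀ (d : D) (e : E.sec U), d • e = κ.hom.toFun d • e) : IsComplete D (E.sec U) :=
  isComplete_of_glue (E.isSeparatedByGerms_sec κ hD hκ) (E.germsGlue_sec κ hD hκ)

end OMod

/-! ### Sections of `MSpec M` -/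

section MSpec

variable (M : ModuleCat.{u} C) {U V : Opens (space C)}

/-- The canonical map `O_X(U) ⊗ M → (MSpec M)(U)`. -/
noncomputable def secMap (U : Opens (space C)) : Sec U ⊗[C] M →ₗ[Sec U] ((MSpec C).obj M).sec U :=
  ((toSections U).app M).hom

theorem restr_secMap (h : V ≤ U) (t : Sec U ⊗[C] M) :
    OMod.restr _ h (secMap M U t) = secMap M V (tensorRes M (homOfLE h) t) :=
  (PresheafOfModules.naturality_apply
    ((sheafifyAdj (structureSheaf C)).unit.app ((tensorPresheaf C).obj M)) (homOfLE h).op t).symm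

theorem exists_secMap_eq (e : ((MSpec C).obj M).sec U) {x : space C} (hx : x ∈ U) :
    ∃ (V : Opens (space C)) (i : V ≤ U) (t : Sec V ⊗[C] M), x ∈ V ∧
      secMap M V t = OMod.restr _ i e := by
  -- On underlying presheaves of abelian groups the unit is the ordinary sheafification map.
  have hloc : Presheaf.IsLocallySurjective (Opens.grothendieckTopology (space C))
      ((PresheafOfModules.toPresheaf _).map
        ((sheafifyAdj (structureSheaf C)).unit.app ((tensorPresheaf C).obj M))) :=
    inferInstanceAs (Presheaf.IsLocallySurjective _ (toSheafify _ _))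
  obtain ⟨V, f, ⟨t, ht⟩, hV⟩ := hloc.imageSieve_mem (U := U) e x hx
  exact ⟨V, f.le, t, hV, ht⟩

theorem exists_tensorRes_eq_zero {t : Sec U ⊗[C] M} (ht : secMap M U t = 0) {x : space C}
    (hx : x ∈ U) : ∃ (V : Opens (space C)) (i : V ≤ U), x ∈ V ∧
      tensorRes M (homOfLE i) t = 0 := by
  have hloc : Presheaf.IsLocallyInjective (Opens.grothendieckTopology (space C))
      ((PresheafOfModules.toPresheaf _).map
        ((sheafifyAdj (structureSheaf C)).unit.app ((tensorPresheaf C).obj M))) :=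
    inferInstanceAs (Presheaf.IsLocallyInjective _ (toSheafify _ _))
  obtain ⟨V, f, h, hV⟩ := hloc.equalizerSieve_mem (X := op U) t 0
    (ht.trans (map_zero (secMap M U)).symm) x hx
  exact ⟨V, f.le, hV, h.trans (map_zero (tensorRes M f))⟩

end MSpec

/-! ### Comparing `M` and its base changes with sections of `MSpec M` -/

open CInftyModule

section

variable (M : ModuleCat.{u} C) {U V : Opens (space C)}

theorem tensorRes_one_tmul (i : V ≤ U) (m : M) :
    tensorRes M (homOfLE i) (1 ⊗ₜ[C] m) = 1 ⊗ₜ[C] m :=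
  congrArg (· ⊗ₜ[C] m) (map_one (resAlgHom (homOfLE i)))

theorem toSec_smul_one_tmul (c : C) (m : M) :
    (toSec U).toFun c • ((1 : Sec U) ⊗ₜ[C] m) = (1 : Sec U) ⊗ₜ[C] (c • m) := by
  rw [TensorProduct.tmul_smul]
  exact algebraMap_smul (Sec U) c ((1 : Sec U) ⊗ₜ[C] m)

theorem point_eq_one {b : C} {x : RPoint C} (h : algebraMap C (GermRing x) b = 1) : x b = 1 := by
  have := congrArg (GermRing.point x) h
  rwa [RPoint.map_one] at this

/-- Near each point of `U`, elements of `O_X(U) ⊗ M` are given by elements of `M`. -/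
theorem exists_toSec_smul_eq (hC : CInftyRing.IsEmbeddable C) (t : Sec U ⊗[C] M) {x : space C}
    (hx : x ∈ U) : ∃ (b : C) (m : M), RPoint.toFun x b ≠ 0 ∧
      (toSec U).toFun b • t = (toSec U).toFun b • ((1 : Sec U) ⊗ₜ[C] m) := by
  induction t with
  | zero => exact ⟨1, 0, by rw [RPoint.map_one]; exact one_ne_zero, by rw [TensorProduct.tmul_zero]⟩
  | tmul s m =>
    have := hC.t1Space
    obtain ⟨V, hV, i, c, hc⟩ := Sec.exists_local s ⟨x, hx⟩
    obtain ⟨b, hb1, hb⟩ := hC.hasPartitions.exists_bump V.isOpen hV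
    refine ⟨b, c • m, by rw [point_eq_one hb1]; exact one_ne_zero, ?_⟩
    rw [← toSec_smul_one_tmul, TensorProduct.smul_tmul', TensorProduct.smul_tmul',
      TensorProduct.smul_tmul', smul_eq_mul, smul_eq_mul, smul_eq_mul, mul_one,
      toSec_mul_eq_toSec_mul (fun y hy => hc ⟨y.1, hy⟩) hb]
  | add t t' ht ht' =>
    obtain ⟨b, m, hb, h⟩ := ht
    obtain ⟨b', m', hb', h'⟩ := ht'
    refine ⟨b * b', m + m', by rw [RPoint.map_mul]; exact mul_ne_zero hb hb', ?_⟩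
    rw [toSec_mul, TensorProduct.tmul_add, smul_add, smul_add, mul_smul, mul_smul _ _ t',
      h', smul_comm, h, smul_comm, ← mul_smul, ← mul_smul]

/-- Elements of `M` vanishing in `O_X(V) ⊗ M` have vanishing germs at the points of `V`. -/
theorem germ_eq_zero_of_one_tmul {m : M} (h : (1 : Sec V) ⊗ₜ[C] m = 0) {x : space C} (hx : x ∈ V) :
    germ C x m = 0 := by
  let σ : Sec V →ₗ[C] GermRing (C := C) x :=
    { toFun := (stalkHom (⟨x, hx⟩ : V)).toRingHom
      map_add' := map_add _
      map_smul' := fun c s => by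
        rw [Algebra.smul_def, map_mul, RingHom.id_apply, Algebra.smul_def]
        rfl }
  have := congrArg (fun t => TensorProduct.comm C _ _ (σ.rTensor M t)) h
  simp only [LinearMap.rTensor_tmul, map_zero, TensorProduct.comm_tmul] at this
  rw [← this]
  exact congrArg (m ⊗ₜ[C] ·) (map_one (stalkHom (⟨x, hx⟩ : V)).toRingHom).symm

theorem germ_eq_zero_of_restr {i : V ≤ U} {m : M}
    (h : OMod.restr _ i (secMap M U (1 ⊗ₜ[C] m)) = 0) {x : space C} (hx : x ∈ V) :
    germ C x m = 0 := by
  rw [restr_secMap, tensorRes_one_tmul] at h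
  obtain ⟨W, j, hW, h⟩ := exists_tensorRes_eq_zero M h hx
  rw [tensorRes_one_tmul] at h
  exact germ_eq_zero_of_one_tmul M h hW

/-- Sections of `MSpec M` are locally given by elements of `M`. -/
theorem exists_restr_secMap_eq (hC : CInftyRing.IsEmbeddable C) (e : ((MSpec C).obj M).sec U)
    {x : space C} (hx : x ∈ U) : ∃ (V : Opens (space C)) (i : V ≤ U) (m : M), x ∈ V ∧
      OMod.restr _ i (secMap M U (1 ⊗ₜ[C] m)) = OMod.restr _ i e := by
  obtain ⟨V, i, t, hV, ht⟩ := exists_secMap_eq M e hx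
  obtain ⟨b, m, hb, hbm⟩ := exists_toSec_smul_eq M hC t hV
  -- The factor `b` is invertible near `x`, so `1 ⊗ m` and `t` have the same image there.
  have h0 : (toSec V).toFun b • secMap M V (1 ⊗ₜ[C] m - t) = 0 := by
    rw [← map_smul, smul_sub, hbm, sub_self, map_zero]
  obtain ⟨W, j, hW, h⟩ := OMod.exists_restr_eq_zero _ h0 ⟨x, hV⟩ hb
  refine ⟨W, j.trans i, m, hW, ?_⟩
  rw [← OMod.restr_restr _ i j, ← OMod.restr_restr _ i j, ← ht, restr_secMap,
    tensorRes_one_tmul, ← sub_eq_zero, ← map_sub, ← map_sub, h]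

/-- Sheafification is locally bijective, and locally tensors come from `M`. The latter allows an
annihilator found over a small open set, after shrinking, to be replaced by an element of `C`, which
acts over all of `U`. -/
theorem germBijective_secMap (hC : CInftyRing.IsEmbeddable C) (U : Opens (space C)) :
    GermBijective (D := Sec U) (secMap M U) := by
  have hU := isEmbeddable_sec hC U
  have key := fun y e => OMod.germ_eq_zero_iff_restr ((MSpec C).obj M) (Chart.sections hC U) hU
    (fun _ _ => rfl) y e
  refine ⟨fun y t ht => ?_, fun y e => ?_⟩
  · obtain ⟨V, i, hV, h⟩ := (key y _).1 ht
    rw [restr_secMap] at h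
    obtain ⟨W, j, hW, h⟩ := exists_tensorRes_eq_zero M h hV
    rw [← tensorRes_comp] at h
    obtain ⟨b, m, hb, hbm⟩ := exists_toSec_smul_eq M hC t (secHomeo hC U y).2
    have h1 : (1 : Sec W) ⊗ₜ[C] (b • m) = 0 := by
      rw [← tensorRes_one_tmul M (j.trans i), ← toSec_smul_one_tmul, ← hbm, tensorRes_smul]
      exact (congrArg _ h).trans (smul_zero _)
    obtain ⟨d, hd, hdm⟩ := germ_eq_zero_iff.1 (germ_eq_zero_of_one_tmul M h1 hW)
    -- The factor `b` replaces `t` by `1 ⊗ m`, and `d` kills `b • m`.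
    refine germ_eq_zero_iff.2 ⟨(toSec U).toFun (d * b), ?_, ?_⟩
    · rw [toSec_mul, RPoint.map_mul]
      exact mul_ne_zero hd hb
    · rw [toSec_mul, mul_smul, hbm, toSec_smul_one_tmul, toSec_smul_one_tmul, hdm,
        TensorProduct.tmul_zero]
  · obtain ⟨V, i, m, hV, h⟩ := exists_restr_secMap_eq M hC e (secHomeo hC U y).2
    refine ⟨1 ⊗ₜ[C] m, ?_⟩
    rw [← sub_eq_zero, ← map_sub, key]
    exact ⟨V, i, hV, by rw [map_sub, h, sub_self]⟩

theorem isComplete_sections (hC : CInftyRing.IsEmbeddable C) (E : OMod C) (U : Opens (space C)) :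
    completeModules (Sec U) (E.sec U) :=
  E.isComplete_sec (Chart.sections hC U) (isEmbeddable_sec hC U) fun _ _ => rfl

theorem isComplete_self_sec (hC : CInftyRing.IsEmbeddable C) (U : Opens (space C)) :
    IsComplete (Sec U) (Sec U) :=
  isComplete_sections hC (SheafOfModules.unit (structureSheaf C)) U

noncomputable instance (E : OMod C) : Module C (E.sec ⊤) := inferInstanceAs (Module C ((Γ C).obj E))

theorem isComplete_Γ (hC : CInftyRing.IsEmbeddable C) (E : OMod C) :
    completeModules C ((Γ C).obj E) :=
  E.isComplete_sec (Chart.global C) hC fun _ _ => rfl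

/-- By construction of the adjunction the unit is `m ↦ secMap M ⊤ (1 ⊗ m)`, so the local description
of sections by elements of `M` applies directly. -/
theorem germBijective_unit (hC : CInftyRing.IsEmbeddable C) :
    GermBijective (D := C) ((adj C).unit.app M).hom := by
  have key := fun y e => OMod.germ_eq_zero_iff_restr ((MSpec C).obj M) (Chart.global C) hC
    (fun _ _ => rfl) y e
  refine ⟨fun y t ht => ?_, fun y e => ?_⟩
  · obtain ⟨V, i, hV, h⟩ := (key y _).1 ht
    exact germ_eq_zero_of_restr M h hV
  · obtain ⟨V, i, m, hV, h⟩ := exists_restr_secMap_eq M hC (U := ⊤) e (x := y) trivial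
    refine ⟨m, ?_⟩
    rw [← sub_eq_zero, ← map_sub]
    exact (key y _).2 ⟨V, i, hV, (map_sub (OMod.restr _ i) _ _).trans (sub_eq_zero.2 h)⟩

end

/-! ### The counit -/

namespace OMod

/-- The map on sections over `U` induced by a morphism of `O_X`-modules. -/
noncomputable def secHom {E F : OMod C} (f : E ⟶ F) (U : Opens (space C)) :
    E.sec U →ₗ[Sec U] F.sec U :=
  ((sectionsFunctor U).map f).hom

theorem restr_secHom {E F : OMod C} (f : E ⟶ F) {U V : Opens (space C)} (h : V ≤ U)
    (e : E.sec U) : F.restr h (secHom f U e) = secHom f V (E.restr h e) :=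
  (PresheafOfModules.naturality_apply f.val (homOfLE h).op e).symm

theorem isIso_of_bijective {E F : OMod C} (f : E ⟶ F)
    (h : ∀ U, Function.Bijective (secHom f U)) : IsIso f := by
  have h1 : IsIso ((PresheafOfModules.toPresheaf _).map f.val) := by
    rw [NatTrans.isIso_iff_isIso_app]
    intro U
    rw [ConcreteCategory.isIso_iff_bijective]
    exact h U.unop
  have h2 : IsIso ((SheafOfModules.forget _).map f) :=
    isIso_of_reflects_iso f.val (PresheafOfModules.toPresheaf _)
  exact isIso_of_reflects_iso f (SheafOfModules.forget _)

/-- Local injectivity gives injectivity over every open set, which forces local preimages to agree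
on overlaps, so they glue. -/
theorem isIso_of_locally_bijective {E F : OMod C} (f : E ⟶ F)
    (hinj : ∀ (U : Opens (space C)) (e : E.sec U), secHom f U e = 0 → ∀ x ∈ U,
      ∃ (V : Opens (space C)) (i : V ≤ U), x ∈ V ∧ E.restr i e = 0)
    (hsurj : ∀ (U : Opens (space C)) (e : F.sec U), ∀ x ∈ U,
      ∃ (V : Opens (space C)) (i : V ≤ U), x ∈ V ∧ ∃ e', secHom f V e' = F.restr i e) :
    IsIso f := by
  have hinj' : ∀ U, Function.Injective (secHom f U) := fun U =>
    (injective_iff_map_eq_zero _).2 fun e he => E.eq_of_locally_eq fun x hx => by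
      obtain ⟨V, i, hV, h⟩ := hinj U e he x hx
      exact ⟨V, i, hV, by rw [h, map_zero]⟩
  refine isIso_of_bijective f fun U => ⟨hinj' U, fun e => ?_⟩
  choose V i hV e' he' using fun x : U => hsurj U e x.1 x.2
  obtain ⟨l, hl⟩ := E.exists_glue V i (fun x hx => ⟨⟨x, hx⟩, hV _⟩) e' fun a b => by
    apply hinj'
    rw [← restr_secHom, ← restr_secHom, he', he', restr_restr, restr_restr]
  refine ⟨l, F.eq_of_locally_eq fun x hx => ⟨V ⟨x, hx⟩, i _, hV _, ?_⟩⟩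
  rw [restr_secHom, hl, he']

/-- Sections are locally restrictions of global sections. -/
theorem exists_global (hC : CInftyRing.IsEmbeddable C) (E : OMod C) {U : Opens (space C)}
    (e : E.sec U) {x : space C} (hx : x ∈ U) :
    ∃ (V : Opens (space C)) (i : V ≤ U) (e' : E.sec ⊤), x ∈ V ∧
      E.restr le_top e' = E.restr i e := by
  have := hC.t1Space
  obtain ⟨b, hb1, hb⟩ := hC.hasPartitions.exists_bump U.isOpen hx
  have hopen : ∀ c : C, IsOpen {y : RPoint C | algebraMap C (GermRing y) b =
      algebraMap C (GermRing y) c} := by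
    intro c
    rw [isOpen_iff_mem_nhds]
    intro y hy
    obtain ⟨d, hd, hdb⟩ := (GermRing.algebraMap_eq y).1 hy
    filter_upwards [(RPoint.isOpen_ne_zero d).mem_nhds hd] with z hz
    exact (GermRing.algebraMap_eq z).2 ⟨d, hz, hdb⟩
  let Z : Opens (space C) := ⟨_, hopen 0⟩
  let V : Opens (space C) := ⟨_, hopen 1⟩
  have hZ : ∀ W ≤ Z, (toSec W).toFun b = 0 := fun W hW => Sec.ext fun y => by
    rw [Sec.zero_val, toSec_val]
    exact (hW y.2).trans (map_zero _)
  have hV : ∀ W ≤ V, (toSec W).toFun b = 1 := fun W hW => Sec.ext fun y => by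
    rw [Sec.one_val, toSec_val]
    exact (hW y.2).trans (map_one _)
  -- Extension by zero: `b • e` on `U` is glued with `0` on `Z`, where `b` has zero germs. On `U ⊓
  -- V`, where `b` has the germs of `1`, the result is `e`.
  let cov : ULift.{u} Bool → Opens (space C) := fun a => if a.down then U else Z
  let s : ∀ a, E.sec (cov a) := fun a => match a with
    | ⟨true⟩ => (toSec U).toFun b • e
    | ⟨false⟩ => (0 : E.sec Z)
  have h0 : ∀ (W : Opens (space C)) (i : W ≤ U), W ≤ Z →
      E.restr i ((toSec U).toFun b • e) = 0 := by
    intro W i hW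
    rw [restr_smul]
    change (toSec W).toFun b • _ = _
    rw [hZ W hW, zero_smul]
  obtain ⟨e', he'⟩ := E.exists_glue (U := ⊤) cov (fun _ => le_top)
    (fun y _ => by
      by_cases hy : y ∈ U
      · exact ⟨⟨true⟩, hy⟩
      · exact ⟨⟨false⟩, (hb y hy).trans (map_zero _).symm⟩) s (by
      rintro ⟨_ | _⟩ ⟨_ | _⟩
      · rfl
      · exact (map_zero (E.restr _)).trans (h0 (Z ⊓ U) inf_le_right inf_le_left).symm
      · exact (h0 (U ⊓ Z) inf_le_left inf_le_right).trans (map_zero (E.restr _)).symm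
      · rfl)
  have h1 : E.restr le_top e' = (toSec U).toFun b • e := he' ⟨true⟩
  refine ⟨U ⊓ V, inf_le_left, e', ⟨hx, hb1.trans (map_one _).symm⟩, ?_⟩
  rw [← restr_restr E le_top inf_le_left, h1, restr_smul]
  change (toSec (U ⊓ V)).toFun b • _ = _
  rw [hV _ inf_le_right, one_smul]

end OMod

/-- A morphism from `MSpec M` to `E` is an isomorphism if the corresponding map from `M` to global
sections is surjective and reflects the vanishing of germs. -/
theorem isIso_of_global (hC : CInftyRing.IsEmbeddable C) {M : ModuleCat.{u} C} {E : OMod C}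
    (f : (MSpec C).obj M ⟶ E) (g : M → E.sec ⊤)
    (hg : ∀ m, OMod.secHom f ⊤ (secMap M ⊤ ((1 : Sec (⊤ : Opens (space C))) ⊗ₜ[C] m)) = g m)
    (hinj : ∀ (m : M) (V : Opens (space C)) (x : RPoint C), x ∈ V →
      E.restr (le_top : V ≤ ⊤) (g m) = 0 → germ C x m = 0)
    (hsurj : ∀ e, ∃ m, g m = e) : IsIso f := by
  have hf : ∀ (U : Opens (space C)) (m : M),
      OMod.secHom f U (secMap M U ((1 : Sec U) ⊗ₜ[C] m)) = E.restr le_top (g m) := by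
    intro U m
    rw [← tensorRes_one_tmul M (le_top : U ≤ ⊤), ← restr_secMap, ← OMod.restr_secHom, hg]
  refine OMod.isIso_of_locally_bijective f (fun U e he x hx => ?_) fun U e x hx => ?_
  · obtain ⟨V, i, m, hV, h⟩ := exists_restr_secMap_eq M hC e hx
    have h2 : E.restr (le_top : V ≤ ⊤) (g m) = 0 := by
      rw [← hf, ← tensorRes_one_tmul M i, ← restr_secMap, h, ← OMod.restr_secHom, he, map_zero]
    -- Here `e` agrees on `V` with the image of `m`, whose germ at `x` vanishes. An annihilator of
    -- `m` in `C` that is nonzero at `x` is invertible near `x`, so `e` is zero there.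
    obtain ⟨d, hd, hdm⟩ := germ_eq_zero_iff.1 (hinj m V x hV h2)
    have h3 : (toSec U).toFun d • secMap M U (1 ⊗ₜ[C] m) = 0 := by
      rw [← map_smul, toSec_smul_one_tmul, hdm, TensorProduct.tmul_zero, map_zero]
    obtain ⟨W, j, hW, h4⟩ := OMod.exists_restr_eq_zero _ h3 ⟨x, hx⟩ hd
    refine ⟨V ⊓ W, inf_le_left.trans i, ⟨hV, hW⟩, ?_⟩
    rw [← OMod.restr_restr _ i inf_le_left, ← h, OMod.restr_restr,
      ← OMod.restr_restr _ j inf_le_right, h4, map_zero]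
  · obtain ⟨V, i, e', hV, h⟩ := E.exists_global hC e hx
    obtain ⟨m, rfl⟩ := hsurj e'
    exact ⟨V, i, hV, _, (hf V m).trans h⟩

/-- By the triangle identity the induced map on global sections, precomposed with the unit, is the
identity of `Γ E`. -/
theorem isIso_counit_app (hC : CInftyRing.IsEmbeddable C) (E : OMod C) :
    IsIso ((adj C).counit.app E) :=
  isIso_of_global hC (M := (Γ C).obj E) (E := E) ((adj C).counit.app E) (fun m => m)
    (fun m => congrArg (fun φ => φ.hom m) ((adj C).right_triangle_components E))
    (fun m V x hV h => (E.germ_eq_zero_iff_restr (Chart.global C) hC (fun _ _ => rfl) x m).2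
      ⟨V, le_top, hV, h⟩)
    fun e => ⟨e, rfl⟩

theorem isIso_counit (hC : CInftyRing.IsEmbeddable C) : IsIso (adj C).counit := by
  have := isIso_counit_app hC
  exact NatIso.isIso_of_isIso_app _

theorem isIso_unit_app (hC : CInftyRing.IsEmbeddable C) {M : ModuleCat.{u} C}
    (hM : completeModules C M) : IsIso ((adj C).unit.app M) :=
  (ConcreteCategory.isIso_iff_bijective _).2 ((germBijective_unit M hC).bijective
    hC.hasPartitions hM (isComplete_Γ hC ((MSpec C).obj M)).isSeparated)

/-- Base change preserves finite presentation, so the source is already complete and a germwise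
bijective map from it is bijective. -/
theorem isIso_toSections (hC : CInftyRing.IsEmbeddable C) (M : ModuleCat.{u} C)
    (hM : Module.FinitePresentation C M) (U : Opens (space C)) : IsIso ((toSections U).app M) := by
  have hU := (isEmbeddable_sec hC U).hasPartitions
  exact (ConcreteCategory.isIso_iff_bijective _).2 ((germBijective_secMap M hC U).bijective hU
    (hU.isComplete_of_finitePresentation (isComplete_self_sec hC U) (Sec U ⊗[C] M))
    (isComplete_sections hC ((MSpec C).obj M) U).isSeparated)

/-! ### Reflections -/

/-- `MSpec` and `Γ` are inverse equivalences between complete modules and `O_X`-modules. -/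
theorem exists_equivalence (hC : CInftyRing.IsEmbeddable C) :
    ∃ e : (completeModules C).FullSubcategory ≌ OMod C,
      e.functor = (completeModules C).ι ⋙ MSpec C ∧
        e.inverse = (completeModules C).lift (Γ C) (isComplete_Γ hC) := by
  let η : 𝟭 (completeModules C).FullSubcategory ⟶ ((completeModules C).ι ⋙ MSpec C) ⋙
      (completeModules C).lift (Γ C) (isComplete_Γ hC) :=
    { app := fun M => (completeModules C).homMk ((adj C).unit.app M.obj)
      naturality := fun M N f => ObjectProperty.hom_ext _ ((adj C).unit.naturality f.hom) }
  have hη : ∀ M, IsIso (η.app M) := fun M => by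
    have : IsIso ((completeModules C).ι.map (η.app M)) := isIso_unit_app hC M.property
    exact isIso_of_reflects_iso (η.app M) (completeModules C).ι
  have hη' : IsIso η := NatIso.isIso_of_isIso_app _
  have := isIso_counit hC
  refine ⟨{
    functor := (completeModules C).ι ⋙ MSpec C
    inverse := (completeModules C).lift (Γ C) (isComplete_Γ hC)
    unitIso := asIso η
    counitIso := (show (completeModules C).lift (Γ C) (isComplete_Γ hC) ⋙
      (completeModules C).ι ⋙ MSpec C ≅ 𝟭 (OMod C) from asIso (adj C).counit)
    functor_unitIso_comp := fun M => (adj C).left_triangle_components M.obj }, rfl, rfl⟩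

/-- The inclusion of complete modules has a left adjoint. -/
theorem isRightAdjoint_ι (hC : CInftyRing.IsEmbeddable C) :
    (completeModules C).ι.IsRightAdjoint := by
  obtain ⟨e, he, -⟩ := exists_equivalence hC
  have := (adj C).isRightAdjoint
  have hiso : ∀ M, IsIso ((Functor.whiskerLeft (completeModules C).ι (adj C).unit).app M) :=
    fun M => isIso_unit_app hC M.property
  have hnat : IsIso (Functor.whiskerLeft (completeModules C).ι (adj C).unit) :=
    NatIso.isIso_of_isIso_app _
  have h : (e.functor ⋙ Γ C).IsRightAdjoint := inferInstance
  rw [he] at h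
  have h' : ((completeModules C).ι ⋙ MSpec C ⋙ Γ C).IsRightAdjoint := h
  -- The inclusion is isomorphic to `MSpec` on complete modules, an equivalence, followed by the
  -- right adjoint `Γ`.
  exact Functor.isRightAdjoint_of_iso
    (asIso (Functor.whiskerLeft (completeModules C).ι (adj C).unit)).symm

end CSpec

/-- A natural germwise bijective transformation to complete modules identifies its target with the
reflection of its source. -/
theorem CInftyModule.exists_iso_reflection {D : Type u} [CInftyRing D] (hD : HasPartitions D)
    {𝒜 : Type*} [Category 𝒜] {B G : 𝒜 ⥤ ModuleCat.{u} D} (τ : B ⟶ G)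
    (hτ : ∀ M, GermBijective (D := D) (τ.app M).hom) (hG : ∀ M, completeModules D (G.obj M))
    (R : ModuleCat.{u} D ⥤ (completeModules D).FullSubcategory) (h : R ⊣ (completeModules D).ι) :
    ∃ α : G ≅ B ⋙ R ⋙ (completeModules D).ι,
      ∀ M, τ.app M ≫ α.hom.app M = h.unit.app (B.obj M) := by
  have hext : ∀ M {K : ModuleCat.{u} D}, completeModules D K → ∀ f g : G.obj M ⟶ K,
      τ.app M ≫ f = τ.app M ≫ g → f = g := fun M K hK f g hfg =>
    ModuleCat.hom_ext ((hτ M).hom_ext hK (congrArg ModuleCat.Hom.hom hfg))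
  have hex : ∀ M {K : ModuleCat.{u} D}, completeModules D K → ∀ f : B.obj M ⟶ K,
      ∃ g : G.obj M ⟶ K, τ.app M ≫ g = f := fun M K hK f => by
    obtain ⟨g, hg⟩ := (hτ M).exists_extension hD hK f.hom
    exact ⟨ModuleCat.ofHom g, ModuleCat.hom_ext hg⟩
  -- Both `G M` and `R (B M)` are universal among complete modules under `B M`. The comparison maps
  -- `a` and `b` are mutually inverse by the two uniqueness statements, which also give naturality
  -- of `a`.
  choose a ha using fun M => hex M (R.obj (B.obj M)).property (h.unit.app (B.obj M))
  let b : ∀ M, (R.obj (B.obj M)).obj ⟶ G.obj M := fun M =>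
    (completeModules D).ι.map ((h.homEquiv (B.obj M) ⟨G.obj M, hG M⟩).symm (τ.app M))
  have hb : ∀ M, h.unit.app (B.obj M) ≫ b M = τ.app M := fun M =>
    (h.homEquiv_unit _ _ _).symm.trans (Equiv.apply_symm_apply _ _)
  have hba : ∀ M, b M ≫ a M = 𝟙 _ := fun M => by
    have h1 : (completeModules D).homMk (X := R.obj (B.obj M)) (Y := R.obj (B.obj M))
        (b M ≫ a M) = 𝟙 _ := by
      apply (h.homEquiv _ _).injective
      rw [h.homEquiv_unit, h.homEquiv_unit]
      change h.unit.app (B.obj M) ≫ b M ≫ a M = h.unit.app (B.obj M) ≫ 𝟙 _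
      rw [← Category.assoc, hb, ha, Category.comp_id]
    exact congrArg (fun f => f.hom) h1
  have hab : ∀ M, a M ≫ b M = 𝟙 _ := fun M => hext M (hG M) _ _ (by
    rw [← Category.assoc, ha, hb, Category.comp_id])
  refine ⟨NatIso.ofComponents (fun M => ⟨a M, b M, hab M, hba M⟩) fun {M N} f => ?_, ha⟩
  refine hext M (R.obj (B.obj N)).property _ _ ?_
  change τ.app M ≫ G.map f ≫ a N = τ.app M ≫ a M ≫ (R.map (B.map f)).hom
  rw [← Category.assoc, ← τ.naturality, Category.assoc, ha, ← Category.assoc, ha]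
  exact h.unit.naturality (B.map f)

theorem theorem6p7 (C : Type u) [CInftyRing C] :
    -- parts (a), (b), (c), for `C` fair
    (CInftyRing.IsFair C →
      -- the reflection `R` onto complete modules exists, and `Γ (MSpec M) ≅ R M` naturally in `M`,
      -- identifying the unit `Φ_M : M ⟶ Γ (MSpec M)` with the projection `M ⟶ R M`
      ((completeModules C).ι.IsRightAdjoint ∧
        (∀ (R : ModuleCat.{u} C ⥤ (completeModules C).FullSubcategory)
          (h : R ⊣ (completeModules C).ι),
          ∃ α : CSpec.MSpec C ⋙ CSpec.Γ C ≅ R ⋙ (completeModules C).ι,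
            ∀ M : ModuleCat.{u} C, (CSpec.adj C).unit.app M ≫ α.hom.app M = h.unit.app M) ∧
        ∀ M : ModuleCat.{u} C, completeModules C M → IsIso ((CSpec.adj C).unit.app M)) ∧
      -- `Γ E` is complete, and the natural map `MSpec (Γ E) ⟶ E` is an isomorphism
      ((∀ E : CSpec.OMod C, completeModules C ((CSpec.Γ C).obj E)) ∧ IsIso (CSpec.adj C).counit) ∧
      -- `MSpec` and `Γ` are inverse equivalences
      ∃ (hΓ : ∀ E : CSpec.OMod C, completeModules C ((CSpec.Γ C).obj E))
        (e : (completeModules C).FullSubcategory ≌ CSpec.OMod C),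
        e.functor = (completeModules C).ι ⋙ CSpec.MSpec C ∧
          e.inverse = (completeModules C).lift (CSpec.Γ C) hΓ) ∧
    -- parts (d), (e), for `C` finitely generated
    (CInftyRing.IsFinitelyGenerated C →
      (∀ U : Opens (CSpec.space C),
        (completeModules (CSpec.Sec U)).ι.IsRightAdjoint ∧
        ∀ (R : ModuleCat.{u} (CSpec.Sec U) ⥤ (completeModules (CSpec.Sec U)).FullSubcategory)
          (h : R ⊣ (completeModules (CSpec.Sec U)).ι),
          ∃ α : CSpec.MSpec C ⋙ CSpec.sectionsFunctor U ≅
              CSpec.baseChange U ⋙ R ⋙ (completeModules (CSpec.Sec U)).ι,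
            ∀ M : ModuleCat.{u} C, (CSpec.toSections U).app M ≫ α.hom.app M =
              h.unit.app ((CSpec.baseChange U).obj M)) ∧
      ∀ M : ModuleCat.{u} C, Module.FinitePresentation C M →
        ∀ U : Opens (CSpec.space C), IsIso ((CSpec.toSections U).app M)) := by
  refine ⟨fun h => ?_, fun h => ?_⟩
  · have hC := h.1.isEmbeddable
    exact ⟨⟨CSpec.isRightAdjoint_ι hC, fun R hR =>
      CInftyModule.exists_iso_reflection hC.hasPartitions (CSpec.adj C).unit
        (CSpec.germBijective_unit · hC) (fun M => CSpec.isComplete_Γ hC _) R hR,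
      fun M hM => CSpec.isIso_unit_app hC hM⟩,
      ⟨CSpec.isComplete_Γ hC, CSpec.isIso_counit hC⟩,
      CSpec.isComplete_Γ hC, CSpec.exists_equivalence hC⟩
  · have hC := h.isEmbeddable
    -- The reflection for `O_X(U)`-modules exists by the equivalence for `Spec O_X(U)`, with
    -- `O_X(U)` as the base ring.
    refine ⟨fun U => ⟨CSpec.isRightAdjoint_ι (CSpec.isEmbeddable_sec hC U), fun R hR =>
      CInftyModule.exists_iso_reflection (CSpec.isEmbeddable_sec hC U).hasPartitions
        (CSpec.toSections U) (CSpec.germBijective_secMap · hC U)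
        (fun M => CSpec.isComplete_sections hC _ U) R hR⟩,
      fun M hM U => CSpec.isIso_toSections hC M hM U⟩
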